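/- **Setting.** Let $U,H$ be real separable (infinite-dimensional) Hilbert spaces, $T>0$, and $(\Omega,\mathcal F,\mathbb P,(\mathcal F_t)_{t\ge 0})$ a probability space with a normal filtration. Let $Q$ be a non-negative self-adjoint trace class operator on $U$ with an orthonormal basis $(e_k)_{k\ge1}$ of eigenvectors and eigenvalues $\eta_k\ge 0$. Let $\mathcal U=Q^{1/2}(U)$ with inner product $(u,v)_{\mathcal U}=(Q^{-1/2}u,Q^{-1/2}v)_U$ ($Q^{-1/2}$ the pseudo-inverse), and let $\mathcal L_{HS}(\mathcal U,H)$ be the space of Hilbert–Schmidt operators, so $\|O\|^2_{\mathcal L_{HS}(\mathcal U,H)}=\sum_{k:\,\eta_k>0}\eta_k\|Oe_k\|_H^2$. Let $W$ be a $Q$-Wiener process on $[0,T]$ with respect to $(\mathcal F_t)$, i.e. $W(0)=0$, paths are continuous, $W$ is adapted, and $W(t)-W(s)$ is independent of $\mathcal F_s$ with law $\mathcal N(0,(t-s)Q)$ for $0\le s\le t\le T$. Let $A$ be a self-adjoint operator on $H$ such that $H$ has an orthonormal basis $(f_n)_{n\ge1}$ of eigenvectors of $-A$ with eigenvalues $0<\lambda_1\le\lambda_2\le\dots\to\infty$.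 For $\alpha\ge 0$ put $\dot H^\alpha=D((-A)^{\alpha/2})$ with $\|v\|_{\dot H^\alpha}^2=\sum_n\lambda_n^\alpha (v,f_n)_H^2$. Fix $\alpha\ge1$ and assume: * $F:H\to H$ and $G:H\to\mathcal L_{HS}(\mathcal U,H)$ are twice Fréchet differentiable and their first and second derivatives are bounded on $H$; * there is a constant $c$ with $\|F(v)\|_{\dot H^\alpha}+\|G(v)\|_{\mathcal L_{HS}(\mathcal U,\dot H^\alpha)}\le c(1+\|v\|_{\dot H^\alpha})$ and $\|G'(v)\|_{\mathcal L(\dot H^\alpha,\mathcal L_{HS}(\mathcal U,\dot H^\alpha))}\le c$ for all $v\in\dot H^\alpha$; * $r$ is a real rational function with $r(z)=e^{-z}+\mathcal O(z^2)$ as $z\to0$, $|r(z)|<1$ for $z>0$, and $\lim_{z\to\infty}r(z)=0$. Call $X_0:\Omega\to H$ admissible if it is $\mathcal F_0$-measurable and lies in $L^8(\Omega;\dot H^\alpha)$. **Schemes.** For a finite-dimensional subspace $V_N\subset\dot H^1$ (with $N=\dim V_N$) let $P_N$ be the $H$-orthogonal projection onto $V_N$, and let $-A_N:V_N\to V_N$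 be given by $(-A_Nv,w)_H=((-A)^{1/2}v,(-A)^{1/2}w)_H$ for $v,w\in V_N$. Let $(\tilde f_n)_{n=1}^N$ be an $H$-orthonormal basis of $V_N$ with $-A_N\tilde f_n=\tilde\lambda_n\tilde f_n$, and $r(\Delta t A_N)v=\sum_{n=1}^N r(\Delta t\,\tilde\lambda_n)(v,\tilde f_n)_H\tilde f_n$. For $M,K\in\mathbb N=\{1,2,\dots\}$ let $\Delta t=T/M$, $t_m=m\Delta t$, $\Delta_mw_k=\eta_k^{-1/2}(W(t_{m+1})-W(t_m),e_k)_U$ for $\eta_k>0$, and $\Delta_mW_K=\sum_{k\le K,\,\eta_k>0}\sqrt{\eta_k}\,\Delta_mw_k\,e_k$. The truncated Milstein scheme is $Y_0=P_NX_0$ and, for $m=0,\dots,M-1$, $$Y_{m+1}=r(\Delta tA_N)P_N\Big(Y_m+F(Y_m)\Delta t+G(Y_m)\Delta_mW_K+\tfrac12\sum_{\substack{k,l\le K\\ \eta_k,\eta_l>0}}G'(Y_m)\big(P_NG(Y_m)e_l\big)e_k\,\big(\sqrt{\eta_k\eta_l}\,\Delta_mw_k\Delta_mw_l-\delta_{kl}\eta_k\Delta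 t\big)\Big).$$ The standard Euler scheme is $\widehat Y_0=P_NX_0$ and $$\widehat Y_{m+1}=r(\Delta tA_N)\widehat Y_m+r(\Delta tA_N)P_NF(\widehat Y_m)\Delta t+r(\Delta tA_N)P_NG(\widehat Y_m)\Delta_mW_K .$$ **Theorem.** 1. For every $p\in[2,8]$ there is a constant $C>0$ such that for all admissible $X_0$, all $M,K\in\mathbb N$ and all finite-dimensional subspaces $V_N\subset\dot H^1$, $$\max_{m=0,\dots,M}\mathbb E\|Y_m\|_H^p\le C\,(1+\mathbb E\|X_0\|_H^p)<\infty .$$ 2. For every admissible $X_0$ and every $p\in(0,4]$ there is a constant $C>0$ such that for all $M,K\in\mathbb N$ and all finite-dimensional subspaces $V_N\subset\dot H^1$, $$\max_{m=0,\dots,M}\big(\mathbb E\|Y_m-\widehat Y_m\|_H^p\big)^{1/p}\le C\,M^{-1/2}.$$ In particular, the constants are independent of $M$, $N$ and $K$. -/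

import Mathlib

open MeasureTheory ProbabilityTheory Filter Topology Asymptotics
open scoped NNReal ENNReal RealInnerProductSpace

noncomputable section

namespace MilsteinSPDE

/-! ### The covariance operator, its square root and the space `𝒰 = Q^{1/2}(U)` -/

/-- A non-negative self-adjoint trace class operator `Q` on `U` together with an orthonormal basis
`(e k)` of eigenvectors and the eigenvalues `η k`. The trace of `Q` is `∑ k, η k`. The indices
start at `0`, and no particular ordering of the eigenvalues is required. -/
structure CovOp (U : Type*) [NormedAddCommGroup U] [InnerProductSpace ℝ U] where
  /-- the operator -/
  Q : U →L[ℝ] U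
  /-- the eigenbasis -/
  e : HilbertBasis ℕ ℝ U
  /-- the eigenvalues -/
  η : ℕ → ℝ
  isPositive : Q.IsPositive
  eigen : ∀ k, Q (e k) = η k • e k
  summable : Summable η

namespace CovOp

variable {U : Type*} [NormedAddCommGroup U] [InnerProductSpace ℝ U] (c : CovOp U)

theorem eta_nonneg (k : ℕ) : 0 ≤ c.η k := by
  have h := c.isPositive.inner_nonneg_left (c.e k)
  rw [c.eigen, real_inner_smul_left, real_inner_self_eq_norm_sq, c.e.orthonormal.1 k] at h
  simpa using h

theorem summable_sqrt_mul (φ : U) : Summable fun k => ‖√(c.η k) * ⟪c.e k, φ⟫‖ := by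
  have h1 : Summable fun k => ⟪c.e k, φ⟫ ^ 2 := by
    refine (c.e.summable_inner_mul_inner φ φ).congr fun k => ?_
    rw [real_inner_comm, sq]
  refine Summable.of_nonneg_of_le (fun _ => norm_nonneg _) (fun k => ?_) (c.summable.add h1)
  rw [Real.norm_eq_abs, abs_mul, abs_of_nonneg (Real.sqrt_nonneg _), ← sq_abs ⟪c.e k, φ⟫]
  nlinarith [Real.sq_sqrt (c.eta_nonneg k), sq_nonneg (√(c.η k) - |⟪c.e k, φ⟫|),
    Real.sqrt_nonneg (c.η k), abs_nonneg ⟪c.e k, φ⟫, mul_nonneg (Real.sqrt_nonneg (c.η k))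
    (abs_nonneg ⟪c.e k, φ⟫)]

variable [CompleteSpace U]

theorem summable_sqrt_smul (φ : U) :
    Summable fun k => (√(c.η k) * ⟪c.e k, φ⟫) • c.e k := by
  refine Summable.of_norm ((c.summable_sqrt_mul φ).congr fun k => ?_)
  rw [norm_smul, c.e.orthonormal.1 k, mul_one]

/-- `Q^{1/2} φ = ∑ k, √(η k) (e k, φ) e k`, as a linear map. -/
def sqrtLin : U →ₗ[ℝ] U where
  toFun φ := ∑' k, (√(c.η k) * ⟪c.e k, φ⟫) • c.e k
  map_add' φ ψ := by
    rw [← (c.summable_sqrt_smul φ).tsum_add (c.summable_sqrt_smul ψ)]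
    refine tsum_congr fun k => ?_
    rw [inner_add_right, mul_add, add_smul]
  map_smul' a φ := by
    rw [RingHom.id_apply, ← (c.summable_sqrt_smul φ).tsum_const_smul a]
    refine tsum_congr fun k => ?_
    rw [real_inner_smul_right, smul_smul]
    ring_nf

theorem inner_sqrtLin (φ ψ : U) :
    ⟪c.sqrtLin φ, ψ⟫ = ∑' k, √(c.η k) * ⟪c.e k, φ⟫ * ⟪c.e k, ψ⟫ := by
  have h := (c.summable_sqrt_smul φ).hasSum.mapL (innerSL ℝ ψ)
  rw [real_inner_comm]
  refine h.tsum_eq.symm.trans (tsum_congr fun k => ?_)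
  rw [innerSL_apply_apply, real_inner_smul_right, real_inner_comm ψ]

theorem sqrtLin_isSymmetric : c.sqrtLin.IsSymmetric := by
  intro φ ψ
  rw [inner_sqrtLin, real_inner_comm, inner_sqrtLin]
  exact tsum_congr fun k => by ring

/-- The square root `Q^{1/2}` as a bounded operator. -/
def sqrtOp : U →L[ℝ] U := ⟨c.sqrtLin, c.sqrtLin_isSymmetric.continuous⟩

/-- The vector space `𝒰 = Q^{1/2}(U)`. It carries its own norm, not the one of `U`. -/
def Rkhs : Type _ := ↥(LinearMap.range c.sqrtLin)

instance : AddCommGroup c.Rkhs := inferInstanceAs (AddCommGroup ↥(LinearMap.range c.sqrtLin))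

instance : Module ℝ c.Rkhs := inferInstanceAs (Module ℝ ↥(LinearMap.range c.sqrtLin))

/-- The inclusion of `𝒰` in `U`. -/
def incl : c.Rkhs →ₗ[ℝ] U := (LinearMap.range c.sqrtLin).subtype

theorem incl_injective : Function.Injective c.incl := Subtype.val_injective

/-- `Q^{1/2}` as a map onto `𝒰`. -/
def toRkhs : U →ₗ[ℝ] c.Rkhs := c.sqrtLin.rangeRestrict

theorem incl_toRkhs (φ : U) : c.incl (c.toRkhs φ) = c.sqrtOp φ := rfl

theorem toRkhs_surjective : Function.Surjective c.toRkhs :=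
  LinearMap.surjective_rangeRestrict c.sqrtLin

/-- The kernel of `Q^{1/2}`. -/
def sqrtKer : Submodule ℝ U := LinearMap.ker c.sqrtOp.toLinearMap

theorem mem_sqrtKer (φ : U) : φ ∈ c.sqrtKer ↔ c.toRkhs φ = 0 := by
  rw [← c.incl_injective.eq_iff, map_zero, incl_toRkhs]
  rfl

instance : CompleteSpace c.sqrtKer :=
  (ContinuousLinearMap.isClosed_ker c.sqrtOp).completeSpace_coe

/-- The component of `φ` orthogonal to the kernel of `Q^{1/2}` depends only on `Q^{1/2} φ`. -/
theorem proj_congr {φ ψ : U} (h : c.toRkhs φ = c.toRkhs ψ) :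
    c.sqrtKerᗮ.starProjection φ = c.sqrtKerᗮ.starProjection ψ := by
  have h1 : φ - ψ ∈ c.sqrtKer := by rw [mem_sqrtKer, map_sub, h, sub_self]
  have h2 : c.sqrtKerᗮ.starProjection (φ - ψ) = 0 := by
    rw [Submodule.starProjection_apply_eq_zero_iff]
    exact Submodule.le_orthogonal_orthogonal _ h1
  rwa [map_sub, sub_eq_zero] at h2

/-- The pseudo-inverse `Q^{-1/2}` on `𝒰`: the preimage under `Q^{1/2}` of smallest norm,
that is, the preimage orthogonal to the kernel
(see `toRkhs_pinv` and `norm_pinv_le`). -/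
def pinv : c.Rkhs →ₗ[ℝ] U where
  toFun u := c.sqrtKerᗮ.starProjection (Function.surjInv c.toRkhs_surjective u)
  map_add' u v := by
    rw [← map_add]
    apply c.proj_congr
    simp only [map_add, Function.surjInv_eq]
  map_smul' a u := by
    rw [RingHom.id_apply, ← map_smul]
    apply c.proj_congr
    simp only [map_smul, Function.surjInv_eq]

theorem pinv_toRkhs (φ : U) : c.pinv (c.toRkhs φ) = c.sqrtKerᗮ.starProjection φ :=
  c.proj_congr (Function.surjInv_eq c.toRkhs_surjective _)

theorem toRkhs_pinv (u : c.Rkhs) : c.toRkhs (c.pinv u) = u := by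
  obtain ⟨φ, rfl⟩ := c.toRkhs_surjective u
  rw [pinv_toRkhs]
  have h := Submodule.starProjection_add_starProjection_orthogonal (K := c.sqrtKer) φ
  have h1 : c.toRkhs (c.sqrtKer.starProjection φ) = 0 :=
    (c.mem_sqrtKer _).1 (Submodule.starProjection_apply_mem _ _)
  conv_rhs => rw [← h, map_add, h1, zero_add]

theorem norm_pinv_le (φ : U) : ‖c.pinv (c.toRkhs φ)‖ ≤ ‖φ‖ := by
  rw [pinv_toRkhs]
  exact (ContinuousLinearMap.le_of_opNorm_le _ (Submodule.starProjection_norm_le _) φ).trans_eq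
    (one_mul _)

theorem pinv_injective : Function.Injective c.pinv :=
  Function.LeftInverse.injective c.toRkhs_pinv

/-- `‖u‖_𝒰 = ‖Q^{-1/2} u‖_U`. -/
instance : NormedAddCommGroup c.Rkhs :=
  NormedAddCommGroup.induced c.Rkhs U c.pinv c.pinv_injective

instance : NormedSpace ℝ c.Rkhs := NormedSpace.induced ℝ c.Rkhs U c.pinv

/-- `(u, v)_𝒰 = (Q^{-1/2} u, Q^{-1/2} v)_U`. -/
instance : InnerProductSpace ℝ c.Rkhs where
  inner u v := ⟪c.pinv u, c.pinv v⟫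
  norm_sq_eq_re_inner u := norm_sq_eq_re_inner (𝕜 := ℝ) (c.pinv u)
  conj_inner_symm u v := inner_conj_symm (𝕜 := ℝ) (c.pinv u) (c.pinv v)
  add_left u v w := by rw [map_add, inner_add_left]
  smul_left u v a := by rw [map_smul, inner_smul_left]

theorem inner_rkhs (u v : c.Rkhs) : ⟪u, v⟫ = ⟪c.pinv u, c.pinv v⟫ := rfl

/-- `Q^{1/2}` as a bounded operator onto `𝒰`. -/
def toRkhsL : U →L[ℝ] c.Rkhs :=
  c.toRkhs.mkContinuous 1 fun φ => (c.norm_pinv_le φ).trans_eq (one_mul _).symm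

/-- The vector `√(η k) e k = Q^{1/2} (e k)` of `𝒰`. Those with `η k > 0` form an orthonormal basis
of `𝒰` (see `inner_b` and `ext_b`), the others vanish. -/
def b (k : ℕ) : c.Rkhs := c.toRkhs (c.e k)

theorem incl_b (k : ℕ) : c.incl (c.b k) = √(c.η k) • c.e k := by
  show ∑' j, (√(c.η j) * ⟪c.e j, c.e k⟫) • c.e j = _
  rw [tsum_eq_single k]
  · rw [real_inner_self_eq_norm_sq, c.e.orthonormal.1 k]
    simp
  · intro j hj
    rw [c.e.orthonormal.2 hj]
    simp

theorem b_eq_zero {k : ℕ} (hk : c.η k = 0) : c.b k = 0 := by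
  apply c.incl_injective
  rw [incl_b, hk]
  simp

theorem pinv_b {k : ℕ} (hk : 0 < c.η k) : c.pinv (c.b k) = c.e k := by
  rw [b, pinv_toRkhs, Submodule.starProjection_eq_self_iff, Submodule.mem_orthogonal]
  intro φ hφ
  have h0 : c.sqrtLin φ = 0 := hφ
  have h1 : ⟪φ, c.sqrtLin (c.e k)⟫ = 0 := by
    rw [← c.sqrtLin_isSymmetric, h0, inner_zero_left]
  have h2 : c.sqrtLin (c.e k) = √(c.η k) • c.e k := c.incl_b k
  rw [h2, real_inner_smul_right] at h1
  exact (mul_eq_zero.1 h1).resolve_left (Real.sqrt_pos.2 hk).ne'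

/-- The vectors `b k` with `η k > 0` are orthonormal in `𝒰`. -/
theorem inner_b {j k : ℕ} (hj : 0 < c.η j) (hk : 0 < c.η k) :
    ⟪c.b j, c.b k⟫ = if j = k then (1 : ℝ) else 0 := by
  rw [inner_rkhs, c.pinv_b hj, c.pinv_b hk]
  exact orthonormal_iff_ite.1 c.e.orthonormal j k

variable {H : Type*} [NormedAddCommGroup H] [NormedSpace ℝ H]

/-- The vectors `b k` are total in `𝒰`. -/
theorem ext_b {O O' : c.Rkhs →L[ℝ] H} (h : ∀ k, O (c.b k) = O' (c.b k)) : O = O' := by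
  ext u
  obtain ⟨φ, rfl⟩ := c.toRkhs_surjective u
  have h1 := (c.e.hasSum_repr φ).mapL (O.comp c.toRkhsL)
  have h2 := (c.e.hasSum_repr φ).mapL (O'.comp c.toRkhsL)
  refine h1.unique (h2.congr_fun fun k => ?_)
  rw [map_smul, map_smul]
  exact congrArg _ (h k)

end CovOp

/-! ### Hilbert-Schmidt operators -/

section HilbertSchmidt

variable {U : Type*} [NormedAddCommGroup U] [InnerProductSpace ℝ U] [CompleteSpace U]
variable (c : CovOp U)
variable (H : Type*) [NormedAddCommGroup H] [InnerProductSpace ℝ H]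

/-- The bounded operators `O : 𝒰 → H` with `∑ k, ‖O (√(η k) e k)‖² < ∞`. -/
def hsSubmodule : Submodule ℝ (c.Rkhs →L[ℝ] H) where
  carrier := {O | Summable fun k => ‖O (c.b k)‖ ^ 2}
  zero_mem' := by simp
  add_mem' {O O'} hO hO' := by
    refine Summable.of_nonneg_of_le (fun _ => by positivity) (fun k => ?_)
      ((hO.add hO').mul_left 2)
    have h := norm_add_le (O (c.b k)) (O' (c.b k))
    rw [_root_.add_apply]
    nlinarith [sq_nonneg (‖O (c.b k)‖ - ‖O' (c.b k)‖), norm_nonneg (O (c.b k) + O' (c.b k))]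
  smul_mem' a O hO := by
    refine (hO.mul_left (‖a‖ ^ 2)).congr fun k => ?_
    rw [_root_.smul_apply, norm_smul, mul_pow]

/-- The space `L_HS(𝒰, H)` of Hilbert-Schmidt operators, normed by
`‖O‖² = ∑ k, ‖O (√(η k) e k)‖²` (see `HS.norm_sq`). -/
def HS : Type _ := ↥(hsSubmodule c H)

namespace HS

instance : AddCommGroup (HS c H) := inferInstanceAs (AddCommGroup ↥(hsSubmodule c H))

instance : Module ℝ (HS c H) := inferInstanceAs (Module ℝ ↥(hsSubmodule c H))

variable {c H}

/-- The bounded operator that underlies a Hilbert-Schmidt operator. -/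
def op : HS c H →ₗ[ℝ] c.Rkhs →L[ℝ] H := (hsSubmodule c H).subtype

theorem summable_op (O : HS c H) : Summable fun k => ‖op O (c.b k)‖ ^ 2 := O.2

/-- The square summable sequence `(O (√(η k) e k))_k`. -/
def toLp : HS c H →ₗ[ℝ] lp (fun _ : ℕ => H) 2 where
  toFun O := ⟨fun k => op O (c.b k), memℓp_gen (by simpa using summable_op O)⟩
  map_add' _ _ := rfl
  map_smul' _ _ := rfl

theorem toLp_injective : Function.Injective (toLp (c := c) (H := H)) := by
  intro O O' h
  apply Subtype.val_injective
  refine c.ext_b fun k => ?_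
  exact congrFun (congrArg Subtype.val h) k

instance : NormedAddCommGroup (HS c H) :=
  NormedAddCommGroup.induced (HS c H) (lp (fun _ : ℕ => H) 2) toLp toLp_injective

instance : NormedSpace ℝ (HS c H) :=
  NormedSpace.induced ℝ (HS c H) (lp (fun _ : ℕ => H) 2) toLp

theorem norm_sq (O : HS c H) : ‖O‖ ^ 2 = ∑' k, ‖op O (c.b k)‖ ^ 2 := by
  have h := lp.norm_rpow_eq_tsum (p := 2) (by simp) (toLp O)
  have h1 : ‖toLp O‖ ^ 2 = ∑' k, ‖toLp O k‖ ^ 2 := by simpa using h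
  exact h1

end HS

end HilbertSchmidt

/-! ### The operator `A` and the spaces `Ḣ^α` -/

/-- A self-adjoint (in particular densely defined) operator `A` on `H` for which there is an
orthonormal basis `(f n)` of `H` of eigenvectors of `-A`, with positive non-decreasing eigenvalues
`lam n` that tend to infinity. So `-A` is positive definite, unbounded and boundedly invertible,
and `A` generates the analytic semigroup `S(t) v = ∑ n, exp (-t lam n) (f n, v) f n`. -/
structure Generator (H : Type*) [NormedAddCommGroup H] [InnerProductSpace ℝ H]
    [CompleteSpace H] where
  /-- the operator -/
  A : H →ₗ.[ℝ] H
  isSelfAdjoint : IsSelfAdjoint A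
  /-- the eigenbasis -/
  f : HilbertBasis ℕ ℝ H
  /-- the eigenvalues of `-A` -/
  lam : ℕ → ℝ
  mem_domain : ∀ n, f n ∈ A.domain
  eigen : ∀ n, A ⟨f n, mem_domain n⟩ = -(lam n • f n)
  lam_pos : ∀ n, 0 < lam n
  lam_mono : Monotone lam
  lam_tendsto : Tendsto lam atTop atTop

namespace Generator

variable {H : Type*} [NormedAddCommGroup H] [InnerProductSpace ℝ H] [CompleteSpace H]
variable (S : Generator H)

/-- `Ḣ^α`, the domain of `(-A)^{α/2}`. -/
def dotH (α : ℝ) : Submodule ℝ H where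
  carrier := {v | Summable fun n => S.lam n ^ α * ⟪S.f n, v⟫ ^ 2}
  zero_mem' := by simp
  add_mem' {v w} hv hw := by
    refine Summable.of_nonneg_of_le
      (fun n => mul_nonneg (Real.rpow_nonneg (S.lam_pos n).le _) (sq_nonneg _)) (fun n => ?_)
      ((hv.add hw).mul_left 2)
    rw [inner_add_right]
    nlinarith [mul_nonneg (Real.rpow_nonneg (S.lam_pos n).le α)
      (sq_nonneg (⟪S.f n, v⟫ - ⟪S.f n, w⟫))]
  smul_mem' a v hv := by
    refine (hv.mul_left (a ^ 2)).congr fun n => ?_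
    rw [real_inner_smul_right]
    ring

/-- The norm `‖v‖_{Ḣ^α} = ‖(-A)^{α/2} v‖_H = (∑ n, (lam n)^α (f n, v)²)^{1/2}`, with the value `∞`
off `Ḣ^α`. -/
def dotNorm (α : ℝ) (v : H) : ℝ≥0∞ :=
  (∑' n, ENNReal.ofReal (S.lam n ^ α * ⟪S.f n, v⟫ ^ 2)) ^ (1 / 2 : ℝ)

/-- The Hilbert-Schmidt norm of an operator from `𝒰` to `Ḣ^α`, with the value `∞` if it is not a
Hilbert-Schmidt operator between these spaces. -/
def hsDotNorm {U : Type*} [NormedAddCommGroup U] [InnerProductSpace ℝ U] [CompleteSpace U]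
    {c : CovOp U} (α : ℝ) (O : HS c H) : ℝ≥0∞ :=
  (∑' k, S.dotNorm α (HS.op O (c.b k)) ^ 2) ^ (1 / 2 : ℝ)

/-- The bilinear form `B(v, w) = (v, w)_1 = ((-A)^{1/2} v, (-A)^{1/2} w)_H` on `V = Ḣ^1`, in
coordinates with respect to the basis `f`. -/
def form (v w : H) : ℝ := ∑' n, S.lam n * ⟪S.f n, v⟫ * ⟪S.f n, w⟫

theorem summable_form {v w : H} (hv : v ∈ S.dotH 1) (hw : w ∈ S.dotH 1) :
    Summable fun n => S.lam n * ⟪S.f n, v⟫ * ⟪S.f n, w⟫ := by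
  have hv' : Summable fun n => S.lam n * ⟪S.f n, v⟫ ^ 2 := by
    simpa [dotH] using hv
  have hw' : Summable fun n => S.lam n * ⟪S.f n, w⟫ ^ 2 := by
    simpa [dotH] using hw
  refine Summable.of_norm_bounded (hv'.add hw') fun n => ?_
  have hl := (S.lam_pos n).le
  rw [Real.norm_eq_abs, abs_le]
  constructor
  · nlinarith [mul_nonneg hl (sq_nonneg (⟪S.f n, v⟫ + ⟪S.f n, w⟫)),
      mul_nonneg hl (sq_nonneg ⟪S.f n, v⟫), mul_nonneg hl (sq_nonneg ⟪S.f n, w⟫)]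
  · nlinarith [mul_nonneg hl (sq_nonneg (⟪S.f n, v⟫ - ⟪S.f n, w⟫)),
      mul_nonneg hl (sq_nonneg ⟪S.f n, v⟫), mul_nonneg hl (sq_nonneg ⟪S.f n, w⟫)]

theorem form_comm (v w : H) : S.form v w = S.form w v :=
  tsum_congr fun n => by ring

theorem form_add {v w z : H} (hv : v ∈ S.dotH 1) (hw : w ∈ S.dotH 1) (hz : z ∈ S.dotH 1) :
    S.form v (w + z) = S.form v w + S.form v z := by
  rw [form, form, form, ← (S.summable_form hv hw).tsum_add (S.summable_form hv hz)]
  exact tsum_congr fun n => by rw [inner_add_right, mul_add]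

theorem form_smul (a : ℝ) (v w : H) : S.form v (a • w) = a * S.form v w := by
  rw [form, form, ← tsum_mul_left]
  exact tsum_congr fun n => by rw [real_inner_smul_right]; ring

/-! ### The discrete operator `A_N` on a finite-dimensional subspace `V_N` of `Ḣ^1` -/

variable (VN : Submodule ℝ H) [FiniteDimensional ℝ VN] (hVN : VN ≤ S.dotH 1)

/-- The discrete operator `-A_N : V_N → V_N`, determined by `(-A_N v, w)_H = B(v, w)` for all
`v, w` in `V_N` (see `inner_negAN`). -/
def negAN : VN →ₗ[ℝ] VN where
  toFun v := ∑ i, S.form (stdOrthonormalBasis ℝ VN i : H) (v : H) • stdOrthonormalBasis ℝ VN i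
  map_add' v w := by
    rw [← Finset.sum_add_distrib]
    refine Finset.sum_congr rfl fun i _ => ?_
    rw [Submodule.coe_add, S.form_add (hVN (SetLike.coe_mem _)) (hVN v.2) (hVN w.2), add_smul]
  map_smul' a v := by
    rw [RingHom.id_apply, Finset.smul_sum]
    refine Finset.sum_congr rfl fun i _ => ?_
    rw [Submodule.coe_smul, S.form_smul, smul_smul]

theorem inner_negAN (v w : VN) : ⟪S.negAN VN hVN v, w⟫ = S.form (v : H) (w : H) := by
  have hsum : ∀ s : Finset (Fin (Module.finrank ℝ VN)), ∀ a : Fin (Module.finrank ℝ VN) → ℝ,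
      S.form (v : H) ((∑ i ∈ s, a i • stdOrthonormalBasis ℝ VN i : VN) : H) =
        ∑ i ∈ s, a i * S.form (v : H) (stdOrthonormalBasis ℝ VN i : H) := by
    intro s a
    induction s using Finset.induction_on with
    | empty => simpa using S.form_smul 0 (v : H) 0
    | insert i s hi ih =>
      rw [Finset.sum_insert hi, Finset.sum_insert hi, Submodule.coe_add,
        S.form_add (hVN v.2) (hVN (SetLike.coe_mem _)) (hVN (SetLike.coe_mem _)), ih,
        Submodule.coe_smul, S.form_smul]
  conv_rhs => rw [← (stdOrthonormalBasis ℝ VN).sum_repr w, hsum]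
  show ⟪∑ i, S.form (stdOrthonormalBasis ℝ VN i : H) (v : H) • stdOrthonormalBasis ℝ VN i, w⟫ = _
  rw [sum_inner]
  refine Finset.sum_congr rfl fun i _ => ?_
  rw [real_inner_smul_left, OrthonormalBasis.repr_apply_apply, S.form_comm, mul_comm]

theorem negAN_isSymmetric : (S.negAN VN hVN).IsSymmetric := by
  intro v w
  rw [inner_negAN, real_inner_comm, inner_negAN, form_comm]

/-- The eigenvalues of `-A_N`. -/
def lamN : Fin (Module.finrank ℝ VN) → ℝ := (S.negAN_isSymmetric VN hVN).eigenvalues rfl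

/-- An `H`-orthonormal basis of `V_N` of eigenvectors of `-A_N`. -/
def fN : OrthonormalBasis (Fin (Module.finrank ℝ VN)) ℝ VN :=
  (S.negAN_isSymmetric VN hVN).eigenvectorBasis rfl

theorem negAN_fN (n : Fin (Module.finrank ℝ VN)) :
    S.negAN VN hVN (S.fN VN hVN n) = S.lamN VN hVN n • S.fN VN hVN n :=
  (S.negAN_isSymmetric VN hVN).apply_eigenvectorBasis rfl n

/-- The value of a real rational function at a real number. -/
def _root_.MilsteinSPDE.evalRat (r : RatFunc ℝ) (z : ℝ) : ℝ := r.eval (RingHom.id ℝ) z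

/-- The rational approximation
`r(Δt A_N) v = ∑ n, r(Δt λ_n) (v, f_n)_H f_n` of `exp(Δt A_N)`, where `λ_n` and `f_n` are the
eigenvalues and the orthonormal eigenvectors of `-A_N`. -/
def ratApprox (r : RatFunc ℝ) (dt : ℝ) (v : H) : H :=
  ∑ n, (evalRat r (dt * S.lamN VN hVN n) * ⟪v, (S.fN VN hVN n : H)⟫) • (S.fN VN hVN n : H)

end Generator

/-! ### Assumptions -/

/-- The rational function `r` is stable and at least of first order: `r(z) = exp(-z) + O(z²)` as
`z → 0`, `|r(z)| < 1` for `z > 0`, and `r(z) → 0` as `z → ∞`. -/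
structure IsStableRational (r : RatFunc ℝ) : Prop where
  order : (fun z => evalRat r z - Real.exp (-z)) =O[𝓝 0] fun z => z ^ 2
  abs_lt_one : ∀ z, 0 < z → |evalRat r z| < 1
  tendsto_zero : Tendsto (evalRat r) atTop (𝓝 0)

section Stochastic

variable {U : Type*} [NormedAddCommGroup U] [InnerProductSpace ℝ U] [CompleteSpace U]
variable {H : Type*} [NormedAddCommGroup H] [InnerProductSpace ℝ H] [CompleteSpace H]
variable {Ω : Type*} {mΩ : MeasurableSpace Ω}

/-- A normal filtration: right-continuous, and all null sets are in the initial σ-algebra. -/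
structure IsNormalFiltration (𝓕 : Filtration ℝ≥0 mΩ) (P : Measure Ω) : Prop where
  null_mem : ∀ B, MeasurableSet B → P B = 0 → MeasurableSet[𝓕 0] B
  right_cont : ∀ t, ⨅ s > t, 𝓕 s = 𝓕 t

/-- `W` is, on the time interval `[0, T]`, a `Q`-Wiener process with respect to the filtration `𝓕`:
it starts at zero, has continuous paths, is adapted, and for `s ≤ t` the increment `W t - W s` is
independent of `𝓕 s` with law `N(0, (t - s) Q)`, which means that
`(W t - W s, φ) ∼ N(0, (t - s) (Q φ, φ))` for all `φ`. -/
structure IsQWiener [MeasurableSpace U] [BorelSpace U] (c : CovOp U) (T : ℝ≥0)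
    (𝓕 : Filtration ℝ≥0 mΩ) (P : Measure Ω) (W : ℝ≥0 → Ω → U) : Prop where
  zero : ∀ᵐ ω ∂P, W 0 ω = 0
  cont : ∀ᵐ ω ∂P, ContinuousOn (fun t => W t ω) (Set.Icc 0 T)
  adapted : ∀ t ≤ T, StronglyMeasurable[𝓕 t] (W t)
  indep : ∀ s t, s ≤ t → t ≤ T →
    Indep (MeasurableSpace.comap (fun ω => W t ω - W s ω) inferInstance) (𝓕 s) P
  gaussian : ∀ s t, s ≤ t → t ≤ T → ∀ φ : U,
    P.map (fun ω => ⟪W t ω - W s ω, φ⟫) =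
      gaussianReal 0 ((t - s) * Real.toNNReal ⟪c.Q φ, φ⟫)

/-- The assumptions on `F : H → H` and `G : H → L_HS(𝒰, H)`: both are twice Fréchet differentiable
with bounded derivatives, they satisfy linear growth bounds on `Ḣ^α`, and `G'(v)` is bounded from
`Ḣ^α` to `L_HS(𝒰, Ḣ^α)`, uniformly in `v ∈ Ḣ^α`. -/
structure CoeffAssumption (S : Generator H) (c : CovOp U) (α : ℝ) (F : H → H)
    (G : H → HS c H) : Prop where
  diff_F : Differentiable ℝ F
  diff_F' : Differentiable ℝ (fderiv ℝ F)
  bound_F : ∃ C : ℝ, ∀ v, ‖fderiv ℝ F v‖ + ‖fderiv ℝ (fderiv ℝ F) v‖ ≤ C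
  diff_G : Differentiable ℝ G
  diff_G' : Differentiable ℝ (fderiv ℝ G)
  bound_G : ∃ C : ℝ, ∀ v, ‖fderiv ℝ G v‖ + ‖fderiv ℝ (fderiv ℝ G) v‖ ≤ C
  growth : ∃ C : ℝ≥0, ∀ v ∈ S.dotH α,
    S.dotNorm α (F v) + S.hsDotNorm α (G v) ≤ C * (1 + S.dotNorm α v)
  smooth_G' : ∃ C : ℝ≥0, ∀ v ∈ S.dotH α, ∀ w ∈ S.dotH α,
    S.hsDotNorm α (fderiv ℝ G v w) ≤ C * S.dotNorm α w

/-- The initial value is `𝓕 0`-measurable and lies in `L^8(Ω; Ḣ^α)`. -/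
structure InitialAssumption (S : Generator H) (α : ℝ) (𝓕 : Filtration ℝ≥0 mΩ) (P : Measure Ω)
    (X₀ : Ω → H) : Prop where
  meas : StronglyMeasurable[𝓕 0] X₀
  moment : ∫⁻ ω, S.dotNorm α (X₀ ω) ^ 8 ∂P < ∞

/-! ### The numerical schemes -/

/-- The grid point `t_m = m T / M`. -/
def gridTime (T : ℝ≥0) (M m : ℕ) : ℝ≥0 := m * T / M

/-- The increment `Δ_m w_k = w_k(t_{m+1}) - w_k(t_m)` of the Brownian motion
`w_k = η_k^{-1/2} (W, e_k)_U`, for `η_k > 0`. (For `η_k = 0` it is `0`.) -/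
def incr (c : CovOp U) (W : ℝ≥0 → Ω → U) (T : ℝ≥0) (M m k : ℕ) (ω : Ω) : ℝ :=
  (√(c.η k))⁻¹ * ⟪W (gridTime T M (m + 1)) ω - W (gridTime T M m) ω, c.e k⟫

/-- The truncated noise increment `Δ_m W_K = ∑_{k < K} Δ_m w_k √(η k) e k`, as an element of `𝒰`.
It omits the components `(Δ_m W, e k)` with `η k = 0`, which vanish almost surely. -/
def noiseIncr (c : CovOp U) (W : ℝ≥0 → Ω → U) (T : ℝ≥0) (M K m : ℕ) (ω : Ω) : c.Rkhs :=
  ∑ k ∈ Finset.range K, incr c W T M m k ω • c.b k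

/-- The truncated Milstein correction
`½ ∑_{k, l < K} G'(X) (P_N G(X) e_l) e_k (√(η_k η_l) Δ_m w_k Δ_m w_l - δ_{kl} η_k Δt)`
at `X = v`, written with the vectors `b k = √(η k) e k` of `𝒰`. -/
def correction (c : CovOp U) (VN : Submodule ℝ H) [FiniteDimensional ℝ VN] (G : H → HS c H)
    (W : ℝ≥0 → Ω → U) (T : ℝ≥0) (M K m : ℕ) (ω : Ω) (v : H) : H :=
  (1 / 2 : ℝ) • ∑ k ∈ Finset.range K, ∑ l ∈ Finset.range K,
    (incr c W T M m k ω * incr c W T M m l ω - if k = l then (T : ℝ) / M else 0) •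
      HS.op (fderiv ℝ G v (VN.starProjection (HS.op (G v) (c.b l)))) (c.b k)

/-- The fully discrete truncated Milstein scheme `Y_m`, with `Δt = T / M`. -/
def milstein (S : Generator H) (c : CovOp U) (F : H → H) (G : H → HS c H) (r : RatFunc ℝ)
    (T : ℝ≥0) (W : ℝ≥0 → Ω → U) (X₀ : Ω → H) (VN : Submodule ℝ H) [FiniteDimensional ℝ VN]
    (hVN : VN ≤ S.dotH 1) (M K : ℕ) : ℕ → Ω → H
  | 0, ω => VN.starProjection (X₀ ω)
  | m + 1, ω =>
    let Y := milstein S c F G r T W X₀ VN hVN M K m ω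
    S.ratApprox VN hVN r ((T : ℝ) / M) (VN.starProjection
      (Y + ((T : ℝ) / M) • F Y + HS.op (G Y) (noiseIncr c W T M K m ω)
        + correction c VN G W T M K m ω Y))

/-- The standard Euler scheme `Ŷ_m`, with `Δt = T / M`. -/
def euler (S : Generator H) (c : CovOp U) (F : H → H) (G : H → HS c H) (r : RatFunc ℝ)
    (T : ℝ≥0) (W : ℝ≥0 → Ω → U) (X₀ : Ω → H) (VN : Submodule ℝ H) [FiniteDimensional ℝ VN]
    (hVN : VN ≤ S.dotH 1) (M K : ℕ) : ℕ → Ω → H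
  | 0, ω => VN.starProjection (X₀ ω)
  | m + 1, ω =>
    let Y := euler S c F G r T W X₀ VN hVN M K m ω
    S.ratApprox VN hVN r ((T : ℝ) / M) Y
      + S.ratApprox VN hVN r ((T : ℝ) / M) (VN.starProjection (((T : ℝ) / M) • F Y))
      + S.ratApprox VN hVN r ((T : ℝ) / M)
          (VN.starProjection (HS.op (G Y) (noiseIncr c W T M K m ω)))

end Stochastic

end MilsteinSPDE

end

open MilsteinSPDE

/-!
Both schemes are recursions `Z (m + 1) = Φ (Z m, ΔW_m)` in which the increment `ΔW_m` of the Wiener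
process is independent of the past. Freezing the past (`lintegral_freeze`) therefore reduces every
moment estimate to a single step from a *deterministic* starting point, and such one step estimates
are iterated by a discrete Gronwall argument (`lintegral_recursion_le`). The operator `r(Δt A_N) P_N`
is a contraction of `H` (`norm_ratApprox_le`), so it plays no further part, and neither the dimension
of `V_N` nor its eigenvalues enter the constants.

The one step estimates rest on the `2`-smoothness of `L⁸(Ω; H)`: if `g` is a martingale increment
with respect to `f`, then `(E ‖f + g‖⁸)^{1/4} ≤ (E ‖f‖⁸)^{1/4} + C (E ‖g‖⁸)^{1/4}`
(`MomentBound.add_of_orthogonal`). One step from a fixed `y` has the form `a + Q₁ + Q₂`, where `Q₁` is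
linear in the independent Gaussian coordinates `Δw_k` and `Q₂` is a centred quadratic form in them.
Adding the coordinates one at a time gives
`(E ‖a + Q₁ + Q₂‖⁸)^{1/4} ≤ ‖a‖² + C h ∑ₖ ‖g k‖² + C h² ∑ₖₗ ‖A k l‖²` (`IsNoise.momentBound_chaos`),
and the sums are squared Hilbert-Schmidt norms, so the bound does not depend on the truncation `K`.
That the starting term `‖a‖²` has the constant `1` is what makes the Gronwall argument work.

* For the moments of `Y_m` this yields `‖y‖² + C h (1 + ‖y‖²)` after one step, so `ρ (1 + ‖·‖⁸)` is a
  Lyapunov function for every weight `ρ` that depends on `X₀` only (`lintegral_milsteinStep_le`). The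
  weight `(1 + ‖X₀‖)^{p - 8}` turns the case `p = 8` into the case of any `p ≤ 8`
  (`lintegral_rpow_le_of_weighted`).
* For the difference of the schemes the terms that the schemes have in common contribute
  `‖y - z‖² + C h ‖y - z‖²` and the Milstein correction, being a chaos of order two, contributes only
  `C h² (1 + ‖y‖²)`. Hence `‖y - z‖⁸ + 8 h⁴ (1 + ‖y‖⁸)` is a Lyapunov function of the pair
  (`lintegral_errorFun_step_le`). At time zero it equals `8 h⁴ (1 + ‖P_N X₀‖⁸)`, so the eighth moment
  of the difference is of order `h⁴`, and Jensen's inequality gives the order `h^{1/2}` in `L^p`.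
-/

set_option linter.unusedSectionVars false

namespace MilsteinSPDE

/-! ### Eighth moments of Hilbert space valued random variables -/

section Moments

variable {H : Type*} [NormedAddCommGroup H] [InnerProductSpace ℝ H]
variable {Ω : Type*} {mΩ : MeasurableSpace Ω} {P : Measure Ω}

/-- `f` has a finite eighth moment, with `(E ‖f‖⁸)^{1/4} ≤ A`. The exponent `1/4` makes `A` scale
like `‖f‖²`, so that the bounds for sums of orthogonal increments are additive in `A`. -/
structure MomentBound (P : Measure Ω) (f : Ω → H) (A : ℝ) : Prop where
  meas : AEStronglyMeasurable f P
  int : Integrable (fun ω => ‖f ω‖ ^ 8) P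
  le : ∫ ω, ‖f ω‖ ^ 8 ∂P ≤ A ^ 4

/-- The second order expansion of `‖·‖⁸`, with the remainder bounded by its extreme terms. -/
theorem norm_add_pow_eight_le (s d : H) :
    ‖s + d‖ ^ 8 ≤ ‖s‖ ^ 8 + 8 * (‖s‖ ^ 6 * ⟪s, d⟫) + 468 * (‖s‖ ^ 6 * ‖d‖ ^ 2 + ‖d‖ ^ 8) := by
  have h1 := norm_add_sq_real s d
  have h2 : ⟪s, d⟫ ^ 2 ≤ ‖s‖ ^ 2 * ‖d‖ ^ 2 := by
    rw [← mul_pow, ← sq_abs]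
    exact pow_le_pow_left₀ (abs_nonneg _) (abs_real_inner_le_norm s d) 2
  have hx := sq_nonneg ‖s‖
  have hw := sq_nonneg ‖d‖
  have e1 : ‖s + d‖ ^ 8 = (‖s + d‖ ^ 2) ^ 4 := by ring
  have e2 : ‖s‖ ^ 8 = (‖s‖ ^ 2) ^ 4 := by ring
  have e3 : ‖d‖ ^ 8 = (‖d‖ ^ 2) ^ 4 := by ring
  have e4 : ‖s‖ ^ 6 = (‖s‖ ^ 2) ^ 3 := by ring
  rw [e1, e2, e3, e4, h1]
  generalize ‖s‖ ^ 2 = x at *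
  generalize ‖d‖ ^ 2 = w at *
  generalize ⟪s, d⟫ = i at *
  set h := 2 * i + w with hh
  have k1 : h ^ 2 ≤ 8 * (x * w) + 2 * w ^ 2 := by nlinarith [sq_nonneg (2 * i - w)]
  have k2 : h ^ 4 ≤ 128 * (x * w) ^ 2 + 8 * w ^ 4 := by
    have := pow_le_pow_left₀ (sq_nonneg h) k1 2
    nlinarith [sq_nonneg (8 * (x * w) - 2 * w ^ 2)]
  have k3 : 4 * x * h ^ 3 ≤ 2 * (x ^ 2 * h ^ 2) + 2 * h ^ 4 := by
    nlinarith [mul_nonneg (sq_nonneg h) (sq_nonneg (x - h))]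
  have k4 : x ^ 2 * w ^ 2 ≤ x ^ 3 * w + w ^ 4 := by
    have : x ^ 2 * w ≤ x ^ 3 + w ^ 3 := by
      rcases le_total w x with h | h
      · nlinarith [mul_le_mul_of_nonneg_left h (sq_nonneg x), pow_nonneg hw 3]
      · nlinarith [mul_le_mul (pow_le_pow_left₀ hx h 2) le_rfl hw (sq_nonneg w), pow_nonneg hx 3]
    nlinarith
  have k5 : x ^ 2 * h ^ 2 ≤ x ^ 2 * (8 * (x * w) + 2 * w ^ 2) :=
    mul_le_mul_of_nonneg_left k1 (sq_nonneg x)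
  have k6 : x + 2 * i + w = x + h := by rw [hh]; ring
  rw [k6]
  have k7 : (x + h) ^ 4 = x ^ 4 + 4 * x ^ 3 * (2 * i + w) + 6 * (x ^ 2 * h ^ 2) + 4 * x * h ^ 3
    + h ^ 4 := by rw [← hh]; ring
  have : (x * w) ^ 2 = x ^ 2 * w ^ 2 := by ring
  have k8 : x ^ 2 * (8 * (x * w) + 2 * w ^ 2) = 8 * (x ^ 3 * w) + 2 * (x ^ 2 * w ^ 2) := by ring
  rw [k7]
  nlinarith [mul_nonneg (pow_nonneg hx 3) hw, pow_nonneg hw 4]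

/-- A weighted Young inequality, the pointwise form of Hölder's inequality with exponents
`4/3` and `4`. -/
theorem pow_three_mul_le {A B x y : ℝ} (hA : 0 < A) (hB : 0 < B) (hx : 0 ≤ x) (hy : 0 ≤ y) :
    x ^ 3 * y ≤ A ^ 3 * B * (3 / 4 * (x ^ 4 / A ^ 4) + 1 / 4 * (y ^ 4 / B ^ 4)) := by
  obtain ⟨t, rfl⟩ : ∃ t, x = A * t := ⟨x / A, by field_simp⟩
  obtain ⟨u, rfl⟩ : ∃ u, y = B * u := ⟨y / B, by field_simp⟩
  have ht : 0 ≤ t := nonneg_of_mul_nonneg_right hx hA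
  have hu : 0 ≤ u := nonneg_of_mul_nonneg_right hy hB
  have e : A ^ 3 * B * (3 / 4 * ((A * t) ^ 4 / A ^ 4) + 1 / 4 * ((B * u) ^ 4 / B ^ 4))
      = A ^ 3 * B * (3 / 4 * t ^ 4 + 1 / 4 * u ^ 4) := by field_simp
  have key : t ^ 3 * u ≤ 3 / 4 * t ^ 4 + 1 / 4 * u ^ 4 := by
    nlinarith [sq_nonneg (t ^ 2 - u ^ 2), sq_nonneg (t * (t - u)), sq_nonneg (t ^ 2 - t * u)]
  rw [e]
  calc (A * t) ^ 3 * (B * u) = A ^ 3 * B * (t ^ 3 * u) := by ring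
    _ ≤ _ := mul_le_mul_of_nonneg_left key (by positivity)

namespace MomentBound

variable {f g : Ω → H} {A B : ℝ}

theorem mono (hf : MomentBound P f A) (hA : 0 ≤ A) (h : A ≤ B) : MomentBound P f B :=
  ⟨hf.meas, hf.int, hf.le.trans (pow_le_pow_left₀ hA h 4)⟩

theorem const [IsProbabilityMeasure P] (v : H) : MomentBound P (fun _ => v) (‖v‖ ^ 2) :=
  ⟨aestronglyMeasurable_const, integrable_const _, by simp; exact le_of_eq (by ring)⟩

theorem norm_add_pow_le (a b : H) : ‖a + b‖ ^ 8 ≤ 128 * (‖a‖ ^ 8 + ‖b‖ ^ 8) := by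
  have h := (pow_le_pow_left₀ (norm_nonneg _) (norm_add_le a b) 8).trans
    (add_pow_le (norm_nonneg a) (norm_nonneg b) 8)
  norm_num at h
  exact h

theorem add (hf : MomentBound P f A) (hg : MomentBound P g B) (hA : 0 ≤ A) (hB : 0 ≤ B) :
    MomentBound P (fun ω => f ω + g ω) (4 * (A + B)) := by
  have hi : Integrable (fun ω => 128 * (‖f ω‖ ^ 8 + ‖g ω‖ ^ 8)) P :=
    (hf.int.add hg.int).const_mul _
  have hm : AEStronglyMeasurable (fun ω => f ω + g ω) P := hf.meas.add hg.meas
  have hint : Integrable (fun ω => ‖f ω + g ω‖ ^ 8) P := by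
    refine hi.mono' (hm.norm.pow 8) (ae_of_all _ fun ω => ?_)
    rw [Real.norm_of_nonneg (by positivity)]
    exact norm_add_pow_le _ _
  refine ⟨hm, hint, ?_⟩
  calc ∫ ω, ‖f ω + g ω‖ ^ 8 ∂P ≤ ∫ ω, 128 * (‖f ω‖ ^ 8 + ‖g ω‖ ^ 8) ∂P :=
        integral_mono hint hi fun ω => norm_add_pow_le _ _
    _ = 128 * (∫ ω, ‖f ω‖ ^ 8 ∂P + ∫ ω, ‖g ω‖ ^ 8 ∂P) := by
        rw [integral_const_mul, integral_add hf.int hg.int]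
    _ ≤ 128 * (A ^ 4 + B ^ 4) := by linarith [hf.le, hg.le]
    _ ≤ (4 * (A + B)) ^ 4 := by
        have : A ^ 4 + B ^ 4 ≤ (A + B) ^ 4 := by
          have e : (A + B) ^ 4 = A ^ 4 + B ^ 4 + (4 * A ^ 3 * B + 6 * A ^ 2 * B ^ 2 + 4 * A * B ^ 3) := by
            ring
          rw [e]
          exact le_add_of_nonneg_right (by positivity)
        have h0 : 0 ≤ (A + B) ^ 4 := by positivity
        rw [mul_pow]
        linarith

theorem integrable_pow_mul (hf : MomentBound P f A) (hg : MomentBound P g B) :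
    Integrable (fun ω => ‖f ω‖ ^ 6 * ⟪f ω, g ω⟫) P := by
  refine (hf.int.add hg.int).mono' ((hf.meas.norm.pow 6).mul (hf.meas.inner hg.meas))
    (ae_of_all _ fun ω => ?_)
  rw [norm_mul, Real.norm_of_nonneg (by positivity)]
  have h := norm_inner_le_norm (𝕜 := ℝ) (f ω) (g ω)
  have h2 : ‖f ω‖ ^ 6 * ‖⟪f ω, g ω⟫‖ ≤ ‖f ω‖ ^ 7 * ‖g ω‖ := by
    calc _ ≤ ‖f ω‖ ^ 6 * (‖f ω‖ * ‖g ω‖) := mul_le_mul_of_nonneg_left h (by positivity)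
      _ = _ := by ring
  refine h2.trans ?_
  rcases le_total ‖f ω‖ ‖g ω‖ with h | h
  · calc ‖f ω‖ ^ 7 * ‖g ω‖ ≤ ‖g ω‖ ^ 7 * ‖g ω‖ := by gcongr
      _ ≤ _ := by show _ ≤ ‖f ω‖ ^ 8 + ‖g ω‖ ^ 8; nlinarith [pow_nonneg (norm_nonneg (f ω)) 8]
  · calc ‖f ω‖ ^ 7 * ‖g ω‖ ≤ ‖f ω‖ ^ 7 * ‖f ω‖ := by gcongr
      _ ≤ _ := by show _ ≤ ‖f ω‖ ^ 8 + ‖g ω‖ ^ 8; nlinarith [pow_nonneg (norm_nonneg (g ω)) 8]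

/-- The `2`-smoothness of `L⁸(Ω; H)`: adding an increment `g` that is orthogonal to `f` in the sense
that `E ‖f‖⁶ (f, g) = 0`, for instance a martingale increment, changes `(E ‖f‖⁸)^{1/4}` by at most a
multiple of `(E ‖g‖⁸)^{1/4}`. -/
theorem add_of_orthogonal (hf : MomentBound P f A) (hg : MomentBound P g B) (hA : 0 ≤ A)
    (hB : 0 ≤ B) (h0 : ∫ ω, ‖f ω‖ ^ 6 * ⟪f ω, g ω⟫ ∂P = 0) :
    MomentBound P (fun ω => f ω + g ω) (A + 117 * B) := by
  have hfg := hf.add hg hA hB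
  refine ⟨hfg.meas, hfg.int, ?_⟩
  -- Young's inequality is applied with `A + ε` and `B + ε` to allow for vanishing bounds.
  have key : ∀ ε : ℝ, 0 < ε →
      ∫ ω, ‖f ω + g ω‖ ^ 8 ∂P ≤ (A + ε) ^ 4 + 468 * ((A + ε) ^ 3 * (B + ε) + (B + ε) ^ 4) := by
    intro ε hε
    set a := A + ε with ha
    set b := B + ε with hb
    have ha0 : 0 < a := by positivity
    have hb0 : 0 < b := by positivity
    have hpt : ∀ ω, ‖f ω + g ω‖ ^ 8 ≤ ‖f ω‖ ^ 8 + 8 * (‖f ω‖ ^ 6 * ⟪f ω, g ω⟫)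
        + 468 * (a ^ 3 * b * (3 / 4 / a ^ 4 * ‖f ω‖ ^ 8 + 1 / 4 / b ^ 4 * ‖g ω‖ ^ 8)
          + ‖g ω‖ ^ 8) := by
      intro ω
      have h1 := norm_add_pow_eight_le (f ω) (g ω)
      have h2 := pow_three_mul_le ha0 hb0 (sq_nonneg ‖f ω‖) (sq_nonneg ‖g ω‖)
      simp only [← pow_mul] at h2
      norm_num at h2
      have e : a ^ 3 * b * (3 / 4 * (‖f ω‖ ^ 8 / a ^ 4) + 1 / 4 * (‖g ω‖ ^ 8 / b ^ 4))
        = a ^ 3 * b * (3 / 4 / a ^ 4 * ‖f ω‖ ^ 8 + 1 / 4 / b ^ 4 * ‖g ω‖ ^ 8) := by ring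
      linarith
    have i1 := hf.integrable_pow_mul hg
    have i2 : Integrable (fun ω => 3 / 4 / a ^ 4 * ‖f ω‖ ^ 8) P := hf.int.const_mul _
    have i3 : Integrable (fun ω => 1 / 4 / b ^ 4 * ‖g ω‖ ^ 8) P := hg.int.const_mul _
    have i4 : Integrable (fun ω => 3 / 4 / a ^ 4 * ‖f ω‖ ^ 8 + 1 / 4 / b ^ 4 * ‖g ω‖ ^ 8) P :=
      i2.add i3
    have i5 : Integrable (fun ω => a ^ 3 * b *
      (3 / 4 / a ^ 4 * ‖f ω‖ ^ 8 + 1 / 4 / b ^ 4 * ‖g ω‖ ^ 8)) P := i4.const_mul _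
    have i6 : Integrable (fun ω => a ^ 3 * b *
      (3 / 4 / a ^ 4 * ‖f ω‖ ^ 8 + 1 / 4 / b ^ 4 * ‖g ω‖ ^ 8) + ‖g ω‖ ^ 8) P := i5.add hg.int
    have i7 : Integrable (fun ω => ‖f ω‖ ^ 8 + 8 * (‖f ω‖ ^ 6 * ⟪f ω, g ω⟫)) P :=
      hf.int.add (i1.const_mul 8)
    have h1 := integral_mono hfg.int (i7.add (i6.const_mul 468)) hpt
    simp only [Pi.add_apply] at h1
    rw [integral_add i7 (i6.const_mul 468), integral_add hf.int (i1.const_mul 8),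
      integral_const_mul, integral_const_mul, integral_add i5 hg.int, integral_const_mul,
      integral_add i2 i3, integral_const_mul, integral_const_mul, h0] at h1
    have hf' : ∫ ω, ‖f ω‖ ^ 8 ∂P ≤ a ^ 4 :=
      hf.le.trans (pow_le_pow_left₀ hA (by linarith) 4)
    have hg' : ∫ ω, ‖g ω‖ ^ 8 ∂P ≤ b ^ 4 :=
      hg.le.trans (pow_le_pow_left₀ hB (by linarith) 4)
    have h2 : 3 / 4 / a ^ 4 * ∫ ω, ‖f ω‖ ^ 8 ∂P ≤ 3 / 4 := by
      calc _ ≤ 3 / 4 / a ^ 4 * a ^ 4 := by gcongr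
        _ = _ := by field_simp
    have h3 : 1 / 4 / b ^ 4 * ∫ ω, ‖g ω‖ ^ 8 ∂P ≤ 1 / 4 := by
      calc _ ≤ 1 / 4 / b ^ 4 * b ^ 4 := by gcongr
        _ = _ := by field_simp
    have h4 : a ^ 3 * b * (3 / 4 / a ^ 4 * ∫ ω, ‖f ω‖ ^ 8 ∂P + 1 / 4 / b ^ 4 * ∫ ω, ‖g ω‖ ^ 8 ∂P)
        ≤ a ^ 3 * b * 1 := mul_le_mul_of_nonneg_left (by linarith) (by positivity)
    linarith
  have hlim : Tendsto (fun ε : ℝ => (A + ε) ^ 4 + 468 * ((A + ε) ^ 3 * (B + ε) + (B + ε) ^ 4))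
      (𝓝[>] 0) (𝓝 ((A + 0) ^ 4 + 468 * ((A + 0) ^ 3 * (B + 0) + (B + 0) ^ 4))) := by
    refine Tendsto.mono_left (Continuous.tendsto (by fun_prop) 0) nhdsWithin_le_nhds
  have h1 := ge_of_tendsto hlim (eventually_nhdsWithin_of_forall key)
  refine h1.trans ?_
  -- The cubic terms match since `4 * 117 = 468`.
  have e : (A + 117 * B) ^ 4 = A ^ 4 + 468 * (A ^ 3 * B) + 6 * A ^ 2 * (117 * B) ^ 2
    + 4 * A * (117 * B) ^ 3 + 117 ^ 4 * B ^ 4 := by ring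
  have p1 : 0 ≤ 6 * A ^ 2 * (117 * B) ^ 2 := by positivity
  have p2 : 0 ≤ 4 * A * (117 * B) ^ 3 := by positivity
  have p3 : 0 ≤ B ^ 4 := by positivity
  rw [e, add_zero, add_zero]
  linarith

end MomentBound

end Moments

/-! ### Homogeneous chaos of order one and two in independent noise -/

section Chaos

variable {H : Type*} [NormedAddCommGroup H] [InnerProductSpace ℝ H]
variable {Ω : Type*} {mΩ : MeasurableSpace Ω} {P : Measure Ω}

/-- Independent centred real random variables `ξ k` with variances `v k`, whose moments scale like
those of Gaussian variables of variance at most `h`. -/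
structure IsNoise (P : Measure Ω) (ξ : ℕ → Ω → ℝ) (v : ℕ → ℝ) (κ h : ℝ) : Prop where
  meas : ∀ k, Measurable (ξ k)
  indep : iIndepFun ξ P
  mean : ∀ k, ∫ ω, ξ k ω ∂P = 0
  var : ∀ k, ∫ ω, (ξ k ω ^ 2 - v k) ∂P = 0
  bound : ∀ k, MomentBound P (ξ k) (κ * h)
  bound_sq : ∀ k, MomentBound P (fun ω => ξ k ω ^ 2 - v k) (κ * h ^ 2)

/-- The σ-algebra generated by `ξ 0, …, ξ (K - 1)`. -/
@[reducible]
def past (ξ : ℕ → Ω → ℝ) (K : ℕ) : MeasurableSpace Ω :=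
  ⨆ k ∈ Set.Iio K, MeasurableSpace.comap (ξ k) inferInstance

theorem stronglyMeasurable_past (ξ : ℕ → Ω → ℝ) {k K : ℕ} (hk : k < K) :
    StronglyMeasurable[past ξ K] (ξ k) := by
  have h : Measurable[past ξ K] (ξ k) := by
    refine measurable_iff_comap_le.2 ?_
    exact le_iSup₂_of_le (f := fun k (_ : k ∈ Set.Iio K) => MeasurableSpace.comap (ξ k) inferInstance)
      k hk le_rfl
  exact h.stronglyMeasurable

theorem MomentBound.smul_of_indep {X : Ω → ℝ} {f : Ω → H} {A B : ℝ} (hX : MomentBound P X A)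
    (hf : MomentBound P f B) (h : IndepFun (fun ω => ‖f ω‖) X P) :
    MomentBound P (fun ω => X ω • f ω) (A * B) := by
  have e : (fun ω => ‖X ω • f ω‖ ^ 8) = fun ω => ‖f ω‖ ^ 8 * ‖X ω‖ ^ 8 := by
    ext ω
    rw [norm_smul, mul_pow, mul_comm]
  have h8 : IndepFun (fun ω => ‖f ω‖ ^ 8) (fun ω => ‖X ω‖ ^ 8) P :=
    h.comp (φ := fun x : ℝ => x ^ 8) (ψ := fun x : ℝ => ‖x‖ ^ 8) (by fun_prop) (by fun_prop)
  refine ⟨hX.meas.smul hf.meas, ?_, ?_⟩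
  · rw [e]
    exact h8.integrable_mul hf.int hX.int
  · rw [e, h8.integral_fun_mul_eq_mul_integral hf.int.1 hX.int.1]
    calc (∫ ω, ‖f ω‖ ^ 8 ∂P) * ∫ ω, ‖X ω‖ ^ 8 ∂P ≤ B ^ 4 * A ^ 4 :=
          mul_le_mul hf.le hX.le (integral_nonneg fun _ => by positivity) (by positivity)
      _ = _ := by ring

namespace IsNoise

variable {ξ : ℕ → Ω → ℝ} {v : ℕ → ℝ} {κ h : ℝ}

theorem past_le (hξ : IsNoise P ξ v κ h) (K : ℕ) : past ξ K ≤ mΩ :=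
  iSup₂_le fun k _ => (hξ.meas k).comap_le

theorem indepFun_past (hξ : IsNoise P ξ v κ h) {K : ℕ} {f : Ω → ℝ}
    (hf : StronglyMeasurable[past ξ K] f) {φ : ℝ → ℝ} (hφ : Measurable φ) :
    IndepFun f (fun ω => φ (ξ K ω)) P := by
  have h1 : Indep (⨆ k ∈ Set.Iio K, MeasurableSpace.comap (ξ k) inferInstance)
      (⨆ k ∈ ({K} : Set ℕ), MeasurableSpace.comap (ξ k) inferInstance) P :=
    indep_iSup_of_disjoint (fun k => (hξ.meas k).comap_le) hξ.indep (by simp)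
  rw [iSup_singleton] at h1
  have h2 : IndepFun f (ξ K) P :=
    (IndepFun_iff_Indep _ _ _).2 (indep_of_indep_of_le_left h1 hf.measurable.comap_le)
  exact h2.comp measurable_id hφ

/-- Multiplying a centred function of `ξ K` into a vector that depends on the past makes it
orthogonal to the past. -/
theorem integral_pow_mul_inner_smul (hξ : IsNoise P ξ v κ h) {K : ℕ} {f g : Ω → H}
    (hf : StronglyMeasurable[past ξ K] f) (hg : StronglyMeasurable[past ξ K] g) {φ : ℝ → ℝ}
    (hφ : Measurable φ) (h0 : ∫ ω, φ (ξ K ω) ∂P = 0) :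
    ∫ ω, ‖f ω‖ ^ 6 * ⟪f ω, φ (ξ K ω) • g ω⟫ ∂P = 0 := by
  have hT : StronglyMeasurable[past ξ K] fun ω => ‖f ω‖ ^ 6 * ⟪f ω, g ω⟫ :=
    (hf.norm.pow 6).mul (hf.inner hg)
  have e : ∀ ω, ‖f ω‖ ^ 6 * ⟪f ω, φ (ξ K ω) • g ω⟫ = ‖f ω‖ ^ 6 * ⟪f ω, g ω⟫ * φ (ξ K ω) := by
    intro ω
    rw [real_inner_smul_right]
    ring
  simp_rw [e]
  rw [(hξ.indepFun_past hT hφ).integral_fun_mul_eq_mul_integral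
    (hT.mono (hξ.past_le K)).aestronglyMeasurable
    (hφ.comp (hξ.meas K)).aestronglyMeasurable, h0, mul_zero]

theorem stronglyMeasurable_linear (ξ : ℕ → Ω → ℝ) (g : ℕ → H) (K : ℕ) :
    StronglyMeasurable[past ξ K] fun ω => ∑ k ∈ Finset.range K, ξ k ω • g k :=
  Finset.stronglyMeasurable_fun_sum _ fun _ hk =>
    (stronglyMeasurable_past ξ (Finset.mem_range.1 hk)).smul_const _

theorem stronglyMeasurable_quadratic (ξ : ℕ → Ω → ℝ) (v : ℕ → ℝ) (A : ℕ → ℕ → H) (K : ℕ) :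
    StronglyMeasurable[past ξ K] fun ω => ∑ k ∈ Finset.range K,
      ∑ l ∈ Finset.range K, (ξ k ω * ξ l ω - if k = l then v k else 0) • A k l :=
  Finset.stronglyMeasurable_fun_sum _ fun _ hk => Finset.stronglyMeasurable_fun_sum _ fun _ hl =>
    StronglyMeasurable.smul_const (((stronglyMeasurable_past ξ (Finset.mem_range.1 hk)).mul
      (stronglyMeasurable_past ξ (Finset.mem_range.1 hl))).sub stronglyMeasurable_const) _

variable [IsProbabilityMeasure P]

theorem momentBound_linear (hξ : IsNoise P ξ v κ h) (hκ : 0 ≤ κ) (hh : 0 ≤ h) (y : H) (g : ℕ → H)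
    (K : ℕ) :
    MomentBound P (fun ω => y + ∑ k ∈ Finset.range K, ξ k ω • g k)
      (‖y‖ ^ 2 + 117 * (κ * h) * ∑ k ∈ Finset.range K, ‖g k‖ ^ 2) := by
  induction K with
  | zero => simpa using MomentBound.const y
  | succ K ih =>
    simp_rw [Finset.sum_range_succ, ← add_assoc]
    have h1 : MomentBound P (fun ω => ξ K ω • g K) (κ * h * ‖g K‖ ^ 2) :=
      (hξ.bound K).smul_of_indep (MomentBound.const (g K)) (indepFun_const_left _ _)
    have h2 := ih.add_of_orthogonal h1 (by positivity) (by positivity)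
      (hξ.integral_pow_mul_inner_smul
        (stronglyMeasurable_const.add (stronglyMeasurable_linear ξ g K)) stronglyMeasurable_const
        measurable_id (hξ.mean K))
    convert h2 using 1
    ring

omit [IsProbabilityMeasure P] in
/-- The increment of a quadratic form in `ξ 0, …, ξ (K - 1)` when `ξ K` is added, with the diagonal
term centred. -/
theorem quadratic_succ (ξ : ℕ → Ω → ℝ) (v : ℕ → ℝ) (A : ℕ → ℕ → H) (K : ℕ) (ω : Ω) :
    ∑ k ∈ Finset.range (K + 1), ∑ l ∈ Finset.range (K + 1),
      (ξ k ω * ξ l ω - if k = l then v k else 0) • A k l =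
    (∑ k ∈ Finset.range K, ∑ l ∈ Finset.range K,
      (ξ k ω * ξ l ω - if k = l then v k else 0) • A k l) +
    (ξ K ω • (∑ l ∈ Finset.range K, ξ l ω • (A K l + A l K)) + (ξ K ω ^ 2 - v K) • A K K) := by
  rw [Finset.sum_range_succ]
  simp_rw [Finset.sum_range_succ _ K]
  rw [Finset.sum_add_distrib, Finset.smul_sum]
  have h1 : ∀ l ∈ Finset.range K, (ξ K ω * ξ l ω - if K = l then v K else 0) • A K l
      = (ξ K ω * ξ l ω) • A K l := fun l hl => by
    rw [if_neg (Finset.mem_range.1 hl).ne', sub_zero]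
  have h2 : ∀ k ∈ Finset.range K, (ξ k ω * ξ K ω - if k = K then v k else 0) • A k K
      = (ξ K ω * ξ k ω) • A k K := fun k hk => by
    rw [if_neg (Finset.mem_range.1 hk).ne, sub_zero, mul_comm]
  rw [Finset.sum_congr rfl h1, Finset.sum_congr rfl h2]
  simp only [if_true]
  simp_rw [smul_add, smul_smul, Finset.sum_add_distrib]
  rw [← sq]
  abel

/-- The moment bound for an inhomogeneous chaos of order two. In the order of the index `K`, the
summands that contain `ξ K` form a martingale increment, so the bounds add up. -/
theorem momentBound_chaos (hξ : IsNoise P ξ v κ h) (hκ : 1 ≤ κ) (hh : 0 ≤ h)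
    (y : H) (g : ℕ → H) (A : ℕ → ℕ → H) (K : ℕ) :
    MomentBound P (fun ω => y + ∑ k ∈ Finset.range K, ξ k ω • g k +
        ∑ k ∈ Finset.range K, ∑ l ∈ Finset.range K,
          (ξ k ω * ξ l ω - if k = l then v k else 0) • A k l)
      (‖y‖ ^ 2 + 468 * (κ * h) * ∑ k ∈ Finset.range K, ‖g k‖ ^ 2 + 468 * 234 * (κ * h) ^ 2 *
        ∑ k ∈ Finset.range K, ∑ l ∈ Finset.range K, ‖A k l‖ ^ 2) := by
  have hκ0 : 0 ≤ κ := zero_le_one.trans hκ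
  induction K with
  | zero => simpa using MomentBound.const y
  | succ K ih =>
    set f : Ω → H := fun ω => y + ∑ k ∈ Finset.range K, ξ k ω • g k +
        ∑ k ∈ Finset.range K, ∑ l ∈ Finset.range K,
          (ξ k ω * ξ l ω - if k = l then v k else 0) • A k l with hf
    have hfmeas : StronglyMeasurable[past ξ K] f :=
      (stronglyMeasurable_const.add (stronglyMeasurable_linear ξ g K)).add
        (stronglyMeasurable_quadratic ξ v A K)
    set B : Ω → H := fun ω => g K + ∑ l ∈ Finset.range K, ξ l ω • (A K l + A l K) with hB
    set b : ℝ := ∑ l ∈ Finset.range K, ‖A K l + A l K‖ ^ 2 with hb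
    have hb0 : 0 ≤ b := Finset.sum_nonneg fun _ _ => by positivity
    have hBmeas : StronglyMeasurable[past ξ K] B :=
      stronglyMeasurable_const.add (stronglyMeasurable_linear ξ _ K)
    have hsplit : (fun ω => y + ∑ k ∈ Finset.range (K + 1), ξ k ω • g k +
        ∑ k ∈ Finset.range (K + 1), ∑ l ∈ Finset.range (K + 1),
          (ξ k ω * ξ l ω - if k = l then v k else 0) • A k l) =
        fun ω => f ω + (ξ K ω • B ω + (ξ K ω ^ 2 - v K) • A K K) := by
      ext ω
      have h5 : ∀ s a q r t : H, y + (s + a) + (q + (r + t)) = y + s + q + (a + r + t) := by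
        intros
        abel
      rw [quadratic_succ, Finset.sum_range_succ, hf, hB, smul_add]
      exact h5 _ _ _ _ _
    rw [hsplit]
    have h1 : MomentBound P (fun ω => ξ K ω • B ω) (κ * h * (‖g K‖ ^ 2 + 117 * (κ * h) * b)) :=
      (hξ.bound K).smul_of_indep (hξ.momentBound_linear hκ0 hh _ _ K)
        (hξ.indepFun_past hBmeas.norm measurable_id)
    have h2 : MomentBound P (fun ω => (ξ K ω ^ 2 - v K) • A K K) (κ * h ^ 2 * ‖A K K‖ ^ 2) :=
      (hξ.bound_sq K).smul_of_indep (MomentBound.const (A K K)) (indepFun_const_left _ _)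
    have h3 := h1.add h2 (by positivity) (by positivity)
    have o1 : ∫ ω, ‖f ω‖ ^ 6 * ⟪f ω, ξ K ω • B ω⟫ ∂P = 0 :=
      hξ.integral_pow_mul_inner_smul hfmeas hBmeas measurable_id (hξ.mean K)
    have o2 : ∫ ω, ‖f ω‖ ^ 6 * ⟪f ω, (ξ K ω ^ 2 - v K) • A K K⟫ ∂P = 0 :=
      hξ.integral_pow_mul_inner_smul hfmeas stronglyMeasurable_const
        (φ := fun x => x ^ 2 - v K) (by fun_prop) (hξ.var K)
    have h4 := ih.add_of_orthogonal h3 (by positivity) (by positivity) (by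
      simp_rw [inner_add_right, mul_add]
      rw [integral_add (ih.integrable_pow_mul h1) (ih.integrable_pow_mul h2), o1, o2, add_zero])
    refine h4.mono (by positivity) ?_
    have hbb : b ≤ 2 * (∑ l ∈ Finset.range K, ‖A K l‖ ^ 2 + ∑ l ∈ Finset.range K, ‖A l K‖ ^ 2) := by
      rw [hb, ← Finset.sum_add_distrib, Finset.mul_sum]
      refine Finset.sum_le_sum fun l _ => ?_
      have := norm_add_le (A K l) (A l K)
      nlinarith [sq_nonneg (‖A K l‖ - ‖A l K‖), norm_nonneg (A K l + A l K)]
    rw [Finset.sum_range_succ, Finset.sum_range_succ _ K]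
    simp_rw [Finset.sum_range_succ _ K]
    rw [Finset.sum_add_distrib]
    have hk2 : κ * h ^ 2 ≤ (κ * h) ^ 2 := by
      rw [mul_pow]
      exact mul_le_mul_of_nonneg_right (by nlinarith) (sq_nonneg h)
    have m1 := mul_le_mul_of_nonneg_right hk2 (sq_nonneg ‖A K K‖)
    have m2 := mul_le_mul_of_nonneg_left hbb (sq_nonneg (κ * h))
    have p1 : 0 ≤ (κ * h) ^ 2 * ‖A K K‖ ^ 2 := by positivity
    have e1 : κ * h * (‖g K‖ ^ 2 + 117 * (κ * h) * b)
        = κ * h * ‖g K‖ ^ 2 + 117 * ((κ * h) ^ 2 * b) := by ring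
    rw [e1]
    set X := (κ * h) ^ 2 with hX
    linarith

end IsNoise

end Chaos

/-! ### The coordinates of a Gaussian increment -/

section Gaussian

theorem integrable_pow_eight_gaussian :
    Integrable (fun x : ℝ => ‖x‖ ^ 8) (gaussianReal 0 1) := by
  have h := (memLp_id_gaussianReal (μ := 0) (v := 1) 8).integrable_norm_pow (p := 8) (by norm_num)
  simpa using h

theorem integrable_centered_sq_pow_eight_gaussian :
    Integrable (fun x : ℝ => ‖x ^ 2 - 1‖ ^ 8) (gaussianReal 0 1) := by
  have h := (memLp_id_gaussianReal (μ := 0) (v := 1) 16).integrable_norm_pow (p := 16)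
    (by norm_num)
  refine ((h.add (integrable_const 1)).const_mul 128).mono' (by fun_prop)
    (ae_of_all _ fun x => ?_)
  rw [Real.norm_of_nonneg (by positivity)]
  have h := MomentBound.norm_add_pow_le (x ^ 2) (-1 : ℝ)
  rw [norm_pow, norm_neg, norm_one, one_pow, ← pow_mul, ← sub_eq_add_neg] at h
  exact h

/-- A constant that dominates the moments of the standard normal distribution `N(0, 1)` which are
needed here. -/
noncomputable def gaussConst : ℝ :=
  1 + ∫ x, ‖x‖ ^ 8 ∂gaussianReal 0 1 + ∫ x, ‖x ^ 2 - 1‖ ^ 8 ∂gaussianReal 0 1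

theorem le_gaussConst_pow :
    ∫ x, ‖x‖ ^ 8 ∂gaussianReal 0 1 ≤ gaussConst ^ 4 ∧
      ∫ x, ‖x ^ 2 - 1‖ ^ 8 ∂gaussianReal 0 1 ≤ gaussConst ^ 4 ∧ 1 ≤ gaussConst := by
  have h1 : 0 ≤ ∫ x, ‖x‖ ^ 8 ∂gaussianReal 0 1 := integral_nonneg fun _ => by positivity
  have h2 : 0 ≤ ∫ x, ‖x ^ 2 - 1‖ ^ 8 ∂gaussianReal 0 1 := integral_nonneg fun _ => by positivity
  have h3 : 1 ≤ gaussConst := by rw [gaussConst]; linarith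
  have h4 : gaussConst ≤ gaussConst ^ 4 := le_self_pow₀ h3 (by norm_num)
  refine ⟨le_trans ?_ h4, le_trans ?_ h4, h3⟩ <;> rw [gaussConst] <;> linarith

variable {Ω : Type*} {mΩ : MeasurableSpace Ω} {P : Measure Ω}

theorem momentBound_of_gaussian {ξ : Ω → ℝ} (hξ : Measurable ξ) {w : ℝ≥0}
    (hlaw : P.map ξ = gaussianReal 0 w) :
    ∫ ω, ξ ω ∂P = 0 ∧ ∫ ω, (ξ ω ^ 2 - w) ∂P = 0 ∧ MomentBound P ξ (gaussConst * w) ∧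
      MomentBound P (fun ω => ξ ω ^ 2 - w) (gaussConst * w ^ 2) := by
  have hs : (√(w : ℝ)) ^ 2 = w := Real.sq_sqrt w.2
  have hlaw' : P.map ξ = (gaussianReal 0 1).map (fun x => √w * x) := by
    rw [hlaw, gaussianReal_map_const_mul]
    congr 1
    · simp
    · ext
      simp [hs]
  have hI : ∀ f : ℝ → ℝ, Measurable f →
      ∫ ω, f (ξ ω) ∂P = ∫ x, f (√w * x) ∂gaussianReal 0 1 := by
    intro f hf
    rw [← integral_map (φ := ξ) hξ.aemeasurable hf.aestronglyMeasurable, hlaw',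
      integral_map (by fun_prop) hf.aestronglyMeasurable]
  have hInt : ∀ f : ℝ → ℝ, Measurable f →
      Integrable (fun x => f (√w * x)) (gaussianReal 0 1) → Integrable (fun ω => f (ξ ω)) P := by
    intro f hf hi
    have h1 : Integrable f ((gaussianReal 0 1).map (fun x => √w * x)) :=
      (integrable_map_measure hf.aestronglyMeasurable (by fun_prop)).2 hi
    rw [← hlaw'] at h1
    exact (integrable_map_measure hf.aestronglyMeasurable hξ.aemeasurable).1 h1
  have e1 : ∀ x : ℝ, ‖√w * x‖ ^ 8 = (w : ℝ) ^ 4 * ‖x‖ ^ 8 := by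
    intro x
    rw [norm_mul, mul_pow, Real.norm_of_nonneg (Real.sqrt_nonneg _),
      show √(w : ℝ) ^ 8 = (√(w : ℝ) ^ 2) ^ 4 by ring, hs]
  have e2 : ∀ x : ℝ, ‖(√w * x) ^ 2 - w‖ ^ 8 = (w : ℝ) ^ 8 * ‖x ^ 2 - 1‖ ^ 8 := by
    intro x
    rw [mul_pow, hs, ← mul_sub_one, norm_mul, mul_pow, Real.norm_of_nonneg (NNReal.coe_nonneg w)]
  obtain ⟨m1, m2, -⟩ := le_gaussConst_pow
  refine ⟨?_, ?_, ⟨hξ.aestronglyMeasurable, ?_, ?_⟩, ⟨by fun_prop, ?_, ?_⟩⟩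
  · rw [hI (fun x => x) measurable_id, integral_const_mul, integral_id_gaussianReal, mul_zero]
  · rw [hI (fun x => x ^ 2 - w) (by fun_prop)]
    have hv := variance_eq_integral (μ := gaussianReal 0 1) (X := fun x : ℝ => x) (by fun_prop)
    rw [variance_fun_id_gaussianReal, integral_id_gaussianReal] at hv
    have h2 := ((memLp_id_gaussianReal (μ := 0) (v := 1) 2).integrable_sq)
    simp only [id] at h2
    simp_rw [mul_pow, hs]
    simp only [sub_zero, NNReal.coe_one] at hv
    rw [integral_sub (h2.const_mul _) (integrable_const _), integral_const_mul, ← hv]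
    simp
  · refine hInt (fun x => ‖x‖ ^ 8) (by fun_prop) ?_
    simp_rw [e1]
    exact integrable_pow_eight_gaussian.const_mul _
  · rw [hI (fun x => ‖x‖ ^ 8) (by fun_prop)]
    simp_rw [e1]
    rw [integral_const_mul, mul_pow, mul_comm]
    gcongr
  · refine hInt (fun x => ‖x ^ 2 - w‖ ^ 8) (by fun_prop) ?_
    simp_rw [e2]
    exact integrable_centered_sq_pow_eight_gaussian.const_mul _
  · rw [hI (fun x => ‖x ^ 2 - w‖ ^ 8) (by fun_prop)]
    simp_rw [e2]
    rw [integral_const_mul, mul_pow, mul_comm, ← pow_mul]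
    gcongr

end Gaussian

section Coordinates

variable {U : Type*} [NormedAddCommGroup U] [InnerProductSpace ℝ U] (c : CovOp U)

/-- The coordinate `η_k^{-1/2} (u, e_k)_U`, with the value `0` if `η_k = 0`. -/
noncomputable def coord (k : ℕ) (u : U) : ℝ := (√(c.η k))⁻¹ * ⟪u, c.e k⟫

theorem continuous_coord (k : ℕ) : Continuous (coord c k) := by
  unfold coord
  fun_prop

/-- The variance of the coordinate `k` of a Gaussian variable with covariance `h Q`. -/
noncomputable def coordVar (h : ℝ≥0) (k : ℕ) : ℝ≥0 := if c.η k = 0 then 0 else h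

theorem coordVar_le (h : ℝ≥0) (k : ℕ) : coordVar c h k ≤ h := by
  unfold coordVar
  split_ifs
  · exact zero_le
  · exact le_rfl

theorem inner_Q_sum (s : Finset ℕ) (a : ℕ → ℝ) :
    ⟪c.Q (∑ i ∈ s, a i • c.e i), ∑ i ∈ s, a i • c.e i⟫ = ∑ i ∈ s, a i ^ 2 * c.η i := by
  rw [map_sum]
  simp_rw [map_smul, c.eigen, smul_smul]
  rw [c.e.orthonormal.inner_sum]
  refine Finset.sum_congr rfl fun i _ => ?_
  simp
  ring

variable [MeasurableSpace U] [BorelSpace U]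
variable {Ω : Type*} {mΩ : MeasurableSpace Ω} {P : Measure Ω} [IsProbabilityMeasure P]

/-- The coordinates of a Gaussian variable in the eigenbasis of its covariance are independent, since
the joint characteristic function is determined by the laws of the linear functionals of `u`. -/
theorem isNoise_coord {u : Ω → U} (hu : Measurable u) {h : ℝ≥0}
    (hlaw : ∀ φ : U, P.map (fun ω => ⟪u ω, φ⟫) = gaussianReal 0 (h * Real.toNNReal ⟪c.Q φ, φ⟫)) :
    IsNoise P (fun k ω => coord c k (u ω)) (fun k => coordVar c h k) gaussConst h := by
  have hm : ∀ k, Measurable fun ω => coord c k (u ω) := fun k =>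
    (continuous_coord c k).measurable.comp hu
  have hvar : ∀ (s : Finset ℕ) (t : ℕ → ℝ),
      ((h * Real.toNNReal ⟪c.Q (∑ i ∈ s, (t i * (√(c.η i))⁻¹) • c.e i),
        ∑ i ∈ s, (t i * (√(c.η i))⁻¹) • c.e i⟫ : ℝ≥0) : ℝ) = ∑ i ∈ s, coordVar c h i * t i ^ 2 := by
    intro s t
    have h0 : 0 ≤ ⟪c.Q (∑ i ∈ s, (t i * (√(c.η i))⁻¹) • c.e i),
        ∑ i ∈ s, (t i * (√(c.η i))⁻¹) • c.e i⟫ := c.isPositive.inner_nonneg_left _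
    rw [NNReal.coe_mul, Real.coe_toNNReal _ h0, inner_Q_sum, Finset.mul_sum]
    refine Finset.sum_congr rfl fun i _ => ?_
    unfold coordVar
    rw [mul_pow, inv_pow, Real.sq_sqrt (c.eta_nonneg i)]
    split_ifs with hi
    · simp [hi]
    · field_simp
  have hinner : ∀ (s : Finset ℕ) (t : ℕ → ℝ) (ω : Ω),
      ⟪u ω, ∑ i ∈ s, (t i * (√(c.η i))⁻¹) • c.e i⟫ = ∑ i ∈ s, coord c i (u ω) * t i := by
    intro s t ω
    rw [inner_sum]
    refine Finset.sum_congr rfl fun i _ => ?_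
    rw [real_inner_smul_right, coord]
    ring
  have hk : ∀ k, P.map (fun ω => coord c k (u ω)) = gaussianReal 0 (coordVar c h k) := by
    intro k
    have h1 := hlaw (∑ i ∈ {k}, ((1 : ℝ) * (√(c.η i))⁻¹) • c.e i)
    have h2 := hvar {k} (fun _ => 1)
    simp_rw [hinner {k} (fun _ => 1)] at h1
    simp only [Finset.sum_singleton, mul_one, one_pow] at h1 h2
    rw [h1]
    congr 1
    exact NNReal.coe_injective h2
  have hind : iIndepFun (fun k ω => coord c k (u ω)) P := by
    refine iIndepFun_iff_finset.2 fun s => ?_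
    refine (iIndepFun_iff_charFun_pi (X := s.restrict fun k ω => coord c k (u ω))
      fun i => (hm i).aemeasurable).2 fun t => ?_
    let t' : ℕ → ℝ := fun k => if hk : k ∈ s then t ⟨k, hk⟩ else 0
    have ht' : ∀ i : s, t i = t' i := fun i => by simp [t']
    have hvm : Measurable fun ω => WithLp.toLp 2 fun i : s => coord c i (u ω) := by fun_prop
    have e1 : charFun (P.map fun ω => WithLp.toLp 2 fun i : s => coord c i (u ω)) t
        = charFun (P.map fun ω => ⟪u ω, ∑ i ∈ s, (t' i * (√(c.η i))⁻¹) • c.e i⟫) 1 := by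
      rw [charFun_apply, charFun_apply, integral_map hvm.aemeasurable (by fun_prop),
        integral_map (by fun_prop) (by fun_prop)]
      refine integral_congr_ae (ae_of_all _ fun ω => ?_)
      simp only
      rw [hinner]
      congr 3
      simp only [PiLp.inner_apply, ht', RCLike.inner_apply, conj_trivial, one_mul]
      rw [← Finset.sum_coe_sort s]
      exact Finset.sum_congr rfl fun i _ => by ring
    have e2 : ∀ i : s, charFun (P.map (s.restrict (fun k ω => coord c k (u ω)) i)) (t i)
        = Complex.exp (-((coordVar c h i * t' i ^ 2 : ℝ) : ℂ) / 2) := by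
      intro i
      have : P.map (s.restrict (fun k ω => coord c k (u ω)) i) = gaussianReal 0 (coordVar c h i) :=
        hk i
      rw [this, charFun_gaussianReal, ht']
      congr 1
      push_cast
      ring
    have e3 : (P.map fun ω => WithLp.toLp 2 fun i : s => s.restrict (fun k ω => coord c k (u ω)) i ω)
      = P.map fun ω => WithLp.toLp 2 fun i : s => coord c i (u ω) := rfl
    rw [e3, e1, hlaw, charFun_gaussianReal, Finset.prod_congr rfl fun i _ => e2 i,
      ← Complex.exp_sum]
    congr 1
    have h2 := hvar s t'
    rw [← Finset.sum_div, Finset.sum_neg_distrib, ← Complex.ofReal_sum,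
      Finset.sum_coe_sort s (fun i => (coordVar c h i : ℝ) * t' i ^ 2), ← h2]
    push_cast
    ring
  have hg1 : 0 ≤ gaussConst := zero_le_one.trans le_gaussConst_pow.2.2
  have hle : ∀ k, (coordVar c h k : ℝ) ≤ h := fun k => coordVar_le c h k
  refine ⟨hm, hind, fun k => ?_, fun k => ?_, fun k => ?_, fun k => ?_⟩
  · exact (momentBound_of_gaussian (hm k) (hk k)).1
  · exact (momentBound_of_gaussian (hm k) (hk k)).2.1
  · exact (momentBound_of_gaussian (hm k) (hk k)).2.2.1.mono (by positivity)
      (mul_le_mul_of_nonneg_left (hle k) hg1)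
  · exact (momentBound_of_gaussian (hm k) (hk k)).2.2.2.mono (by positivity)
      (mul_le_mul_of_nonneg_left (pow_le_pow_left₀ (NNReal.coe_nonneg _) (hle k) 2) hg1)

end Coordinates

/-! ### The rational approximation of the semigroup is a contraction -/

section Rational

variable {H : Type*} [NormedAddCommGroup H] [InnerProductSpace ℝ H] [CompleteSpace H]
variable (S : Generator H) (VN : Submodule ℝ H) [FiniteDimensional ℝ VN] (hVN : VN ≤ S.dotH 1)

theorem lamN_pos (n : Fin (Module.finrank ℝ VN)) : 0 < S.lamN VN hVN n := by
  set v : VN := S.fN VN hVN n with hv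
  have hnorm : ‖v‖ = 1 := (S.fN VN hVN).orthonormal.1 n
  have h1 : S.lamN VN hVN n = S.form (v : H) (v : H) := by
    rw [← S.inner_negAN VN hVN, S.negAN_fN, real_inner_smul_left, real_inner_self_eq_norm_sq,
      hnorm]
    simp
  have hne : (v : H) ≠ 0 := by
    intro h0
    rw [ZeroMemClass.coe_eq_zero] at h0
    rw [h0, norm_zero] at hnorm
    exact zero_ne_one hnorm
  obtain ⟨k, hk⟩ : ∃ k, ⟪S.f k, (v : H)⟫ ≠ 0 := by
    by_contra! h0
    refine hne (S.f.repr.injective ?_)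
    ext k
    rw [S.f.repr_apply_apply, h0 k, map_zero]
    rfl
  rw [h1, Generator.form]
  have hpos : ∀ k, 0 ≤ S.lam k * ⟪S.f k, (v : H)⟫ * ⟪S.f k, (v : H)⟫ := fun k => by
    rw [mul_assoc]
    exact mul_nonneg (S.lam_pos k).le (mul_self_nonneg _)
  refine (S.summable_form (hVN v.2) (hVN v.2)).tsum_pos hpos k ?_
  rw [mul_assoc]
  exact mul_pos (S.lam_pos k) (mul_self_pos.2 hk)

theorem orthonormal_fN : Orthonormal ℝ fun n => (S.fN VN hVN n : H) :=
  (S.fN VN hVN).orthonormal.comp_linearIsometry VN.subtypeₗᵢ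

theorem norm_ratApprox_le {r : RatFunc ℝ} (hr : IsStableRational r) {dt : ℝ} (hdt : 0 < dt)
    (v : H) : ‖S.ratApprox VN hVN r dt v‖ ≤ ‖v‖ := by
  have ho := orthonormal_fN S VN hVN
  have h1 : ‖S.ratApprox VN hVN r dt v‖ ^ 2 ≤ ‖v‖ ^ 2 := by
    refine le_trans ?_ (ho.sum_inner_products_le (s := Finset.univ) v)
    rw [← real_inner_self_eq_norm_sq, Generator.ratApprox, ho.inner_sum]
    refine Finset.sum_le_sum fun n _ => ?_
    have h2 := hr.abs_lt_one _ (mul_pos hdt (lamN_pos S VN hVN n))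
    rw [real_inner_comm, conj_trivial, ← sq, mul_pow, Real.norm_eq_abs, sq_abs]
    refine mul_le_of_le_one_left (sq_nonneg _) ?_
    rw [← sq_abs]
    exact pow_le_one₀ (abs_nonneg _) h2.le
  exact le_of_sq_le_sq h1 (norm_nonneg v)

theorem ratApprox_add (r : RatFunc ℝ) (dt : ℝ) (v w : H) :
    S.ratApprox VN hVN r dt (v + w) = S.ratApprox VN hVN r dt v + S.ratApprox VN hVN r dt w := by
  simp_rw [Generator.ratApprox, inner_add_left, mul_add, add_smul, Finset.sum_add_distrib]

theorem ratApprox_neg (r : RatFunc ℝ) (dt : ℝ) (v : H) :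
    S.ratApprox VN hVN r dt (-v) = -S.ratApprox VN hVN r dt v := by
  simp_rw [Generator.ratApprox, inner_neg_left, mul_neg, neg_smul, Finset.sum_neg_distrib]

theorem ratApprox_sub (r : RatFunc ℝ) (dt : ℝ) (v w : H) :
    S.ratApprox VN hVN r dt (v - w) = S.ratApprox VN hVN r dt v - S.ratApprox VN hVN r dt w := by
  rw [sub_eq_add_neg, ratApprox_add, ratApprox_neg, ← sub_eq_add_neg]

theorem ratApprox_starProjection (r : RatFunc ℝ) (dt : ℝ) (v : H) :
    S.ratApprox VN hVN r dt (VN.starProjection v) = S.ratApprox VN hVN r dt v := by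
  refine Finset.sum_congr rfl fun n _ => ?_
  rw [Submodule.inner_starProjection_left_eq_right,
    Submodule.starProjection_eq_self_iff.2 (SetLike.coe_mem _)]

theorem continuous_ratApprox (r : RatFunc ℝ) (dt : ℝ) :
    Continuous (S.ratApprox VN hVN r dt) := by
  unfold Generator.ratApprox
  fun_prop

end Rational

/-! ### Hilbert-Schmidt bounds and the coefficients of the scheme -/

section Coefficients

variable {U : Type*} [NormedAddCommGroup U] [InnerProductSpace ℝ U] [CompleteSpace U]
variable {c : CovOp U}
variable {H : Type*} [NormedAddCommGroup H] [InnerProductSpace ℝ H]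

theorem sum_norm_op_sq_le (O : HS c H) (s : Finset ℕ) :
    ∑ k ∈ s, ‖HS.op O (c.b k)‖ ^ 2 ≤ ‖O‖ ^ 2 := by
  rw [HS.norm_sq]
  exact (HS.summable_op O).sum_le_tsum s fun _ _ => sq_nonneg _

theorem norm_op_b_le (O : HS c H) (k : ℕ) : ‖HS.op O (c.b k)‖ ≤ ‖O‖ := by
  have h := sum_norm_op_sq_le O {k}
  rw [Finset.sum_singleton] at h
  exact le_of_sq_le_sq h (norm_nonneg O)

variable (c H) in
/-- The evaluation `O ↦ O (√(η k) e k)` as a bounded operator on `L_HS(𝒰, H)`. -/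
noncomputable def evalB (k : ℕ) : HS c H →L[ℝ] H :=
  LinearMap.mkContinuous
    { toFun := fun O => HS.op O (c.b k)
      map_add' := fun O O' => by rw [map_add]; rfl
      map_smul' := fun a O => by rw [map_smul]; rfl } 1
    fun O => (norm_op_b_le O k).trans_eq (one_mul _).symm

theorem evalB_apply (k : ℕ) (O : HS c H) : evalB c H k O = HS.op O (c.b k) := rfl

/-- The quantitative consequences of the smoothness of `F` and `G` that the moment bounds use: `F`
and `G` are Lipschitz continuous and of linear growth, and `G'` is bounded and continuous. -/
structure CoeffBound (F : H → H) (G : H → HS c H) (L : ℝ) : Prop where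
  nonneg : 0 ≤ L
  cont_F : Continuous F
  cont_G : Continuous G
  cont_G' : Continuous (fderiv ℝ G)
  growth_F : ∀ y, ‖F y‖ ^ 2 ≤ L * (1 + ‖y‖ ^ 2)
  growth_G : ∀ y, ‖G y‖ ^ 2 ≤ L * (1 + ‖y‖ ^ 2)
  lip_F : ∀ y z, ‖F y - F z‖ ^ 2 ≤ L * ‖y - z‖ ^ 2
  lip_G : ∀ y z, ‖G y - G z‖ ^ 2 ≤ L * ‖y - z‖ ^ 2
  bound_G' : ∀ y w, ‖fderiv ℝ G y w‖ ^ 2 ≤ L * ‖w‖ ^ 2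

theorem sq_growth_of_lipschitz {E : Type*} [NormedAddCommGroup E] {f : H → E} {C : ℝ}
    (hf : ∀ y z, ‖f y - f z‖ ≤ C * ‖y - z‖) (y : H) :
    ‖f y‖ ^ 2 ≤ (2 * ‖f 0‖ ^ 2 + 2 * C ^ 2) * (1 + ‖y‖ ^ 2) := by
  have h1 := hf y 0
  rw [sub_zero] at h1
  have h2 : ‖f y‖ ≤ C * ‖y‖ + ‖f 0‖ := by
    have := norm_add_le (f y - f 0) (f 0)
    rw [sub_add_cancel] at this
    linarith
  have h3 := pow_le_pow_left₀ (norm_nonneg _) h2 2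
  nlinarith [sq_nonneg (C * ‖y‖ - ‖f 0‖), mul_nonneg (sq_nonneg ‖f 0‖) (sq_nonneg ‖y‖),
    sq_nonneg C]

theorem exists_coeffBound [CompleteSpace H] {S : Generator H} {α : ℝ} {F : H → H} {G : H → HS c H}
    (hFG : CoeffAssumption S c α F G) : ∃ L, CoeffBound F G L := by
  obtain ⟨C₁, h₁⟩ := hFG.bound_F
  obtain ⟨C₂, h₂⟩ := hFG.bound_G
  have d₁ : ∀ y, ‖fderiv ℝ F y‖ ≤ C₁ := fun y =>
    (le_add_of_nonneg_right (norm_nonneg (fderiv ℝ (fderiv ℝ F) y))).trans (h₁ y)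
  have d₂ : ∀ y, ‖fderiv ℝ G y‖ ≤ C₂ := fun y =>
    (le_add_of_nonneg_right (norm_nonneg (fderiv ℝ (fderiv ℝ G) y))).trans (h₂ y)
  have l₁ : ∀ y z, ‖F y - F z‖ ≤ C₁ * ‖y - z‖ := fun y z =>
    convex_univ.norm_image_sub_le_of_norm_fderiv_le (fun x _ => hFG.diff_F x) (fun x _ => d₁ x)
      (Set.mem_univ z) (Set.mem_univ y)
  have l₂ : ∀ y z, ‖G y - G z‖ ≤ C₂ * ‖y - z‖ := fun y z =>
    convex_univ.norm_image_sub_le_of_norm_fderiv_le (fun x _ => hFG.diff_G x) (fun x _ => d₂ x)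
      (Set.mem_univ z) (Set.mem_univ y)
  have hle : ∀ {a b x : ℝ}, 0 ≤ x → a ≤ b → a * x ≤ b * x := fun hx h =>
    mul_le_mul_of_nonneg_right h hx
  have p₁ := sq_nonneg ‖F 0‖
  have p₂ := sq_nonneg ‖G 0‖
  have p₃ := sq_nonneg C₁
  have p₄ := sq_nonneg C₂
  refine ⟨2 * ‖F 0‖ ^ 2 + 2 * C₁ ^ 2 + (2 * ‖G 0‖ ^ 2 + 2 * C₂ ^ 2), by positivity,
    hFG.diff_F.continuous, hFG.diff_G.continuous, hFG.diff_G'.continuous, fun y => ?_, fun y => ?_,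
    fun y z => ?_, fun y z => ?_, fun y w => ?_⟩
  · exact (sq_growth_of_lipschitz l₁ y).trans (hle (by positivity) (by linarith))
  · exact (sq_growth_of_lipschitz l₂ y).trans (hle (by positivity) (by linarith))
  · refine (pow_le_pow_left₀ (norm_nonneg _) (l₁ y z) 2).trans ?_
    rw [mul_pow]
    exact hle (by positivity) (by linarith)
  · refine (pow_le_pow_left₀ (norm_nonneg _) (l₂ y z) 2).trans ?_
    rw [mul_pow]
    exact hle (by positivity) (by linarith)
  · refine (pow_le_pow_left₀ (norm_nonneg _)
      ((fderiv ℝ G y).le_of_opNorm_le (d₂ y) w) 2).trans ?_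
    rw [mul_pow]
    exact hle (by positivity) (by linarith)

end Coefficients

/-! ### One step of the schemes from deterministic initial values -/

section OneStep

variable {U : Type*} [NormedAddCommGroup U] [InnerProductSpace ℝ U] [CompleteSpace U]
variable {c : CovOp U}
variable {H : Type*} [NormedAddCommGroup H] [InnerProductSpace ℝ H] [CompleteSpace H]
variable (VN : Submodule ℝ H) [FiniteDimensional ℝ VN]
variable (F : H → H) (G : H → HS c H) (dt : ℝ) (K : ℕ)

/-- The argument of `r(Δt A_N)` in an Euler step from `y` with the increment `u` of the noise. -/
noncomputable def eulerStep (y : H) (u : U) : H :=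
  y + dt • F y + ∑ k ∈ Finset.range K, coord c k u • HS.op (G y) (c.b k)

/-- The vector `G'(y)(P_N G(y) e_l) e_k`, scaled by `√(η_k η_l)`. -/
noncomputable def correctionCoeff (y : H) (k l : ℕ) : H :=
  HS.op (fderiv ℝ G y (VN.starProjection (HS.op (G y) (c.b l)))) (c.b k)

/-- The argument of `r(Δt A_N)` in a Milstein step from `y` with the increment `u` of the noise. -/
noncomputable def milsteinStep (y : H) (u : U) : H :=
  eulerStep F G dt K y u + (1 / 2 : ℝ) • ∑ k ∈ Finset.range K, ∑ l ∈ Finset.range K,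
    (coord c k u * coord c l u - if k = l then dt else 0) • correctionCoeff VN G y k l

theorem correctionCoeff_eq_zero (y : H) {k : ℕ} (l : ℕ) (hk : c.η k = 0) :
    correctionCoeff VN G y k l = 0 := by
  rw [correctionCoeff, c.b_eq_zero hk, map_zero]

variable {F G} {L : ℝ} (hFG : CoeffBound F G L)
include hFG

theorem continuous_eulerStep : Continuous fun p : H × U => eulerStep F G dt K p.1 p.2 := by
  have h1 := hFG.cont_F
  have h2 := hFG.cont_G
  have h3 : ∀ k, Continuous fun p : H × U => coord c k p.2 := fun k =>
    (continuous_coord c k).comp continuous_snd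
  have h4 : ∀ k, Continuous fun p : H × U => HS.op (G p.1) (c.b k) := fun k =>
    (evalB c H k).continuous.comp (h2.comp continuous_fst)
  unfold eulerStep
  fun_prop

theorem continuous_milsteinStep :
    Continuous fun p : H × U => milsteinStep VN F G dt K p.1 p.2 := by
  have h1 := continuous_eulerStep dt K hFG
  have h3 : ∀ k, Continuous fun p : H × U => coord c k p.2 := fun k =>
    (continuous_coord c k).comp continuous_snd
  have h5 : ∀ l, Continuous fun y : H => VN.starProjection (HS.op (G y) (c.b l)) := fun l =>
    VN.starProjection.continuous.comp ((evalB c H l).continuous.comp hFG.cont_G)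
  have h4 : ∀ k l, Continuous fun p : H × U => correctionCoeff VN G p.1 k l := fun k l =>
    ((evalB c H k).continuous.comp (hFG.cont_G'.clm_apply (h5 l))).comp continuous_fst
  unfold milsteinStep
  fun_prop

theorem sum_norm_correctionCoeff_sq_le (y : H) :
    ∑ k ∈ Finset.range K, ∑ l ∈ Finset.range K, ‖correctionCoeff VN G y k l‖ ^ 2
      ≤ L ^ 2 * (1 + ‖y‖ ^ 2) := by
  rw [Finset.sum_comm]
  have h1 : ∀ l, ∑ k ∈ Finset.range K, ‖correctionCoeff VN G y k l‖ ^ 2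
      ≤ L * ‖HS.op (G y) (c.b l)‖ ^ 2 := by
    intro l
    refine (sum_norm_op_sq_le _ _).trans ((hFG.bound_G' _ _).trans ?_)
    refine mul_le_mul_of_nonneg_left (pow_le_pow_left₀ (norm_nonneg _) ?_ 2) hFG.nonneg
    exact (ContinuousLinearMap.le_of_opNorm_le _ (Submodule.starProjection_norm_le _) _).trans_eq
      (one_mul _)
  calc _ ≤ ∑ l ∈ Finset.range K, L * ‖HS.op (G y) (c.b l)‖ ^ 2 :=
        Finset.sum_le_sum fun l _ => h1 l
    _ = L * ∑ l ∈ Finset.range K, ‖HS.op (G y) (c.b l)‖ ^ 2 := by rw [Finset.mul_sum]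
    _ ≤ L * (L * (1 + ‖y‖ ^ 2)) :=
        mul_le_mul_of_nonneg_left ((sum_norm_op_sq_le _ _).trans (hFG.growth_G y)) hFG.nonneg
    _ = _ := by ring

omit hFG in
theorem norm_add_smul_sq_le {h : ℝ} (hh : 0 ≤ h) (y w : H) :
    ‖y + h • w‖ ^ 2 ≤ ‖y‖ ^ 2 + h * (‖y‖ ^ 2 + ‖w‖ ^ 2) + h ^ 2 * ‖w‖ ^ 2 := by
  rw [norm_add_sq_real, real_inner_smul_right, norm_smul, mul_pow, Real.norm_eq_abs, sq_abs]
  have h1 := real_inner_le_norm y w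
  have h2 : 2 * ⟪y, w⟫ ≤ ‖y‖ ^ 2 + ‖w‖ ^ 2 := by nlinarith [sq_nonneg (‖y‖ - ‖w‖)]
  nlinarith [mul_le_mul_of_nonneg_left h2 hh]

/-- The constant in the one step estimates. -/
noncomputable def stepConst (T L : ℝ) : ℝ :=
  1 + L + T * L + 468 * gaussConst * L + 468 * 234 * gaussConst ^ 2 * T * L ^ 2
    + 468 * 234 * gaussConst ^ 2 * L ^ 2

omit hFG in
theorem stepConst_nonneg {T L : ℝ} (hT : 0 ≤ T) (hL : 0 ≤ L) : 0 ≤ stepConst T L := by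
  have hg : 0 ≤ gaussConst := zero_le_one.trans le_gaussConst_pow.2.2
  unfold stepConst
  positivity

variable [MeasurableSpace U] [BorelSpace U]
variable {Ω : Type*} {mΩ : MeasurableSpace Ω} {P : Measure Ω} [IsProbabilityMeasure P]
variable {u : Ω → U} {h : ℝ≥0}

omit hFG [CompleteSpace H] in
theorem momentBound_increment
    (hξ : IsNoise P (fun k ω => coord c k (u ω)) (fun k => coordVar c h k) gaussConst h)
    (a : H) (g : ℕ → H) (A : ℕ → ℕ → H) (hA : ∀ k l, c.η k = 0 → A k l = 0) {x z : ℝ}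
    (hx : ∑ k ∈ Finset.range K, ‖g k‖ ^ 2 ≤ x)
    (hz : ∑ k ∈ Finset.range K, ∑ l ∈ Finset.range K, ‖A k l‖ ^ 2 ≤ z) :
    MomentBound P (fun ω => a + ∑ k ∈ Finset.range K, coord c k (u ω) • g k +
        (1 / 2 : ℝ) • ∑ k ∈ Finset.range K, ∑ l ∈ Finset.range K,
          (coord c k (u ω) * coord c l (u ω) - if k = l then (h : ℝ) else 0) • A k l)
      (‖a‖ ^ 2 + 468 * gaussConst * h * x + 468 * 234 * gaussConst ^ 2 * h ^ 2 * z) := by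
  have hg : 0 ≤ gaussConst := zero_le_one.trans le_gaussConst_pow.2.2
  have h1 := hξ.momentBound_chaos le_gaussConst_pow.2.2 h.2 a g (fun k l => (1 / 2 : ℝ) • A k l) K
  have hz' : ∑ k ∈ Finset.range K, ∑ l ∈ Finset.range K, ‖(1 / 2 : ℝ) • A k l‖ ^ 2 ≤ z := by
    refine le_trans (Finset.sum_le_sum fun k _ => Finset.sum_le_sum fun l _ => ?_) hz
    rw [norm_smul, mul_pow]
    refine mul_le_of_le_one_left (sq_nonneg _) ?_
    norm_num
  have e : ∀ ω, (1 / 2 : ℝ) • ∑ k ∈ Finset.range K, ∑ l ∈ Finset.range K,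
      (coord c k (u ω) * coord c l (u ω) - if k = l then (h : ℝ) else 0) • A k l =
      ∑ k ∈ Finset.range K, ∑ l ∈ Finset.range K, (coord c k (u ω) * coord c l (u ω) -
        if k = l then (coordVar c h k : ℝ) else 0) • ((1 / 2 : ℝ) • A k l) := by
    intro ω
    simp_rw [Finset.smul_sum]
    refine Finset.sum_congr rfl fun k _ => Finset.sum_congr rfl fun l _ => ?_
    rw [smul_comm]
    -- The scheme subtracts `h` on the diagonal even if `η k = 0`, but then the coefficient vanishes.
    by_cases hk : c.η k = 0
    · rw [hA k l hk]
      simp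
    · rw [coordVar, if_neg hk]
  simp_rw [e]
  refine h1.mono (by positivity) ?_
  have n1 : 0 ≤ 468 * (gaussConst * h) := by positivity
  have n2 : 0 ≤ 468 * 234 * (gaussConst * h) ^ 2 := by positivity
  have m1 := mul_le_mul_of_nonneg_left hx n1
  have m2 := mul_le_mul_of_nonneg_left hz' n2
  rw [mul_pow] at m2
  linarith

/-- The moment bound for one Milstein step. -/
theorem momentBound_milsteinStep
    (hξ : IsNoise P (fun k ω => coord c k (u ω)) (fun k => coordVar c h k) gaussConst h)
    {T : ℝ} (hT : h ≤ T) (y : H) :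
    MomentBound P (fun ω => milsteinStep VN F G h K y (u ω))
      (‖y‖ ^ 2 + stepConst T L * h * (1 + ‖y‖ ^ 2)) := by
  have hg : 0 ≤ gaussConst := zero_le_one.trans le_gaussConst_pow.2.2
  have hL := hFG.nonneg
  have hh : (0 : ℝ) ≤ h := h.2
  have hT0 : 0 ≤ T := hh.trans hT
  have h1 := momentBound_increment K hξ (y + (h : ℝ) • F y) (fun k => HS.op (G y) (c.b k))
    (correctionCoeff VN G y) (fun k l => correctionCoeff_eq_zero VN G y l)
    ((sum_norm_op_sq_le _ _).trans (hFG.growth_G y)) (sum_norm_correctionCoeff_sq_le VN K hFG y)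
  refine h1.mono (by positivity) ?_
  have h2 := norm_add_smul_sq_le hh y (F y)
  have h3 := mul_le_mul_of_nonneg_left (hFG.growth_F y) hh
  have h4 := mul_le_mul_of_nonneg_left (hFG.growth_F y) (sq_nonneg (h : ℝ))
  set x := 1 + ‖y‖ ^ 2 with hx
  have hx0 : 0 ≤ x := by positivity
  have h5 : (h : ℝ) ^ 2 * (L * x) ≤ h * T * (L * x) := by
    rw [sq]; gcongr
  have h6 : 468 * 234 * gaussConst ^ 2 * h ^ 2 * (L ^ 2 * x)
      ≤ 468 * 234 * gaussConst ^ 2 * (h * T) * (L ^ 2 * x) := by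
    rw [sq (h : ℝ)]; gcongr
  have h7 : 0 ≤ 468 * 234 * gaussConst ^ 2 * L ^ 2 * h * x := by positivity
  have h8 : h * ‖y‖ ^ 2 ≤ h * x := by gcongr; linarith
  unfold stepConst
  linarith

/-- The moment bound for the difference of a Milstein step and an Euler step. The correction term
contributes `h²` and not only `h`, since it is a chaos of order two. -/
theorem momentBound_milsteinStep_sub_eulerStep
    (hξ : IsNoise P (fun k ω => coord c k (u ω)) (fun k => coordVar c h k) gaussConst h)
    {T : ℝ} (hT : h ≤ T) (y z : H) :
    MomentBound P (fun ω => milsteinStep VN F G h K y (u ω) - eulerStep F G h K z (u ω))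
      (‖y - z‖ ^ 2 + stepConst T L * h * (‖y - z‖ ^ 2 + h * (1 + ‖y‖ ^ 2))) := by
  have hg : 0 ≤ gaussConst := zero_le_one.trans le_gaussConst_pow.2.2
  have hL := hFG.nonneg
  have hh : (0 : ℝ) ≤ h := h.2
  have hT0 : 0 ≤ T := hh.trans hT
  have h1 := momentBound_increment K hξ (y - z + (h : ℝ) • (F y - F z))
    (fun k => HS.op (G y - G z) (c.b k))
    (correctionCoeff VN G y) (fun k l => correctionCoeff_eq_zero VN G y l)
    ((sum_norm_op_sq_le _ _).trans (hFG.lip_G y z)) (sum_norm_correctionCoeff_sq_le VN K hFG y)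
  have e : (fun ω => milsteinStep VN F G h K y (u ω) - eulerStep F G h K z (u ω)) =
      fun ω => y - z + (h : ℝ) • (F y - F z) +
        ∑ k ∈ Finset.range K, coord c k (u ω) • HS.op (G y - G z) (c.b k) +
        (1 / 2 : ℝ) • ∑ k ∈ Finset.range K, ∑ l ∈ Finset.range K,
          (coord c k (u ω) * coord c l (u ω) - if k = l then (h : ℝ) else 0) •
            correctionCoeff VN G y k l := by
    ext ω
    simp_rw [← evalB_apply, map_sub, smul_sub, Finset.sum_sub_distrib, milsteinStep, eulerStep,
      evalB_apply]
    abel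
  rw [e]
  refine h1.mono (by positivity) ?_
  have h2 := norm_add_smul_sq_le hh (y - z) (F y - F z)
  have h3 := mul_le_mul_of_nonneg_left (hFG.lip_F y z) hh
  have h4 := mul_le_mul_of_nonneg_left (hFG.lip_F y z) (sq_nonneg (h : ℝ))
  set d := ‖y - z‖ ^ 2 with hd
  have hd0 : 0 ≤ d := by positivity
  set x := 1 + ‖y‖ ^ 2 with hx
  have hx0 : 0 ≤ x := by positivity
  have h5 : (h : ℝ) ^ 2 * (L * d) ≤ h * T * (L * d) := by
    rw [sq]; gcongr
  have h6 : 0 ≤ (1 + L + T * L + 468 * gaussConst * L +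
    468 * 234 * gaussConst ^ 2 * T * L ^ 2) * (h * (h * x)) := by positivity
  have h7 : 0 ≤ (468 * 234 * gaussConst ^ 2 * T * L ^ 2 + 468 * 234 * gaussConst ^ 2 * L ^ 2) *
    (h * d) := by positivity
  unfold stepConst
  linarith

end OneStep

/-! ### Lyapunov functions of a recursion driven by independent increments -/

section Recursion

theorem secondCountable_of_hilbertBasis {E : Type*} [NormedAddCommGroup E] [InnerProductSpace ℝ E]
    (e : HilbertBasis ℕ ℝ E) : SecondCountableTopology E := by
  have h1 : TopologicalSpace.IsSeparable (Set.univ : Set E) := by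
    have h2 : TopologicalSpace.IsSeparable (Submodule.span ℝ (Set.range e) : Set E) :=
      (Set.countable_range e).isSeparable.span
    have h3 := h2.closure
    have h4 := congrArg (fun V : Submodule ℝ E => (V : Set E)) e.dense_span
    simp only [Submodule.topologicalClosure_coe, Submodule.top_coe] at h4
    rwa [h4] at h3
  have h5 : TopologicalSpace.SeparableSpace E := TopologicalSpace.isSeparable_univ_iff.1 h1
  exact UniformSpace.secondCountable_of_separable E

variable {Ω : Type*} {m₀ : MeasurableSpace Ω} {m : ℕ → MeasurableSpace Ω} {mΩ : MeasurableSpace Ω}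
variable {P : Measure Ω} [IsProbabilityMeasure P]
variable {U E : Type*} [MeasurableSpace U] [MeasurableSpace E]

/-- Freezing an argument: if `f` is measurable with respect to `m₀` and `u` is independent of `m₀`,
then the expectation of a function of `f` and `u` is an iterated integral. -/
theorem lintegral_freeze (hm : m₀ ≤ mΩ) {f : Ω → E} {u : Ω → U}
    (hf : Measurable[m₀] f) (hu : Measurable u)
    (hind : Indep (MeasurableSpace.comap u inferInstance) m₀ P) {φ : E × U → ℝ≥0∞}
    (hφ : Measurable φ) :
    ∫⁻ ω, φ (f ω, u ω) ∂P = ∫⁻ ω, ∫⁻ ω', φ (f ω, u ω') ∂P ∂P := by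
  have hf' : Measurable f := hf.mono hm le_rfl
  have hi : IndepFun f u P :=
    (IndepFun_iff_Indep _ _ _).2 (indep_of_indep_of_le_left hind.symm hf.comap_le)
  have h1 := (indepFun_iff_map_prod_eq_prod_map_map hf'.aemeasurable hu.aemeasurable).1 hi
  have : IsProbabilityMeasure (P.map u) := Measure.isProbabilityMeasure_map hu.aemeasurable
  rw [← lintegral_map hφ (hf'.prodMk hu), h1, lintegral_prod _ hφ.aemeasurable,
    lintegral_map hφ.lintegral_prod_right' hf']
  refine lintegral_congr fun ω => ?_
  exact lintegral_map (f := fun x => φ (f ω, x)) (hφ.comp measurable_prodMk_left) hu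

variable {M : ℕ} {Z : ℕ → Ω → E} {u : ℕ → Ω → U} {Φ : E × U → E}

omit [IsProbabilityMeasure P] in
theorem measurable_recursion (hmono : ∀ n < M, m n ≤ m (n + 1)) (hZ0 : Measurable[m 0] (Z 0))
    (hu : ∀ n < M, Measurable[m (n + 1)] (u n)) (hΦ : Measurable Φ)
    (hstep : ∀ n < M, ∀ ω, Z (n + 1) ω = Φ (Z n ω, u n ω)) :
    ∀ n ≤ M, Measurable[m n] (Z n) := by
  intro n
  induction n with
  | zero => exact fun _ => hZ0
  | succ n ih =>
    intro hn
    have h1 : Measurable[m (n + 1)] (Z n) := (ih (by omega)).mono (hmono n hn) le_rfl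
    have h2 : Z (n + 1) = fun ω => Φ (Z n ω, u n ω) := funext (hstep n hn)
    rw [h2]
    exact hΦ.comp (h1.prodMk (hu n hn))

/-- If one step from a deterministic point multiplies the expectation of `ψ` by at most `q`, then
so does every step of the recursion `Z (n + 1) = Φ (Z n, u n)`. -/
theorem lintegral_recursion_le (hm : ∀ n, m n ≤ mΩ) (hmono : ∀ n < M, m n ≤ m (n + 1))
    (hZ0 : Measurable[m 0] (Z 0)) (hu : ∀ n < M, Measurable[m (n + 1)] (u n))
    (hind : ∀ n < M, Indep (MeasurableSpace.comap (u n) inferInstance) (m n) P)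
    (hΦ : Measurable Φ) (hstep : ∀ n < M, ∀ ω, Z (n + 1) ω = Φ (Z n ω, u n ω))
    {ψ : E → ℝ≥0∞} (hψ : Measurable ψ) {q : ℝ≥0∞}
    (hq : ∀ n < M, ∀ x, ∫⁻ ω, ψ (Φ (x, u n ω)) ∂P ≤ q * ψ x) :
    ∀ n ≤ M, ∫⁻ ω, ψ (Z n ω) ∂P ≤ q ^ n * ∫⁻ ω, ψ (Z 0 ω) ∂P := by
  intro n
  induction n with
  | zero => intro _; simp
  | succ n ih =>
    intro hn
    have hZn := measurable_recursion hmono hZ0 hu hΦ hstep n (by omega)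
    have hψm : Measurable fun ω => ψ (Z n ω) := hψ.comp (hZn.mono (hm n) le_rfl)
    simp_rw [hstep n hn]
    rw [lintegral_freeze (hm n) hZn ((hu n hn).mono (hm (n + 1)) le_rfl) (hind n hn)
      (φ := fun p => ψ (Φ p)) (hψ.comp hΦ)]
    calc _ ≤ ∫⁻ ω, q * ψ (Z n ω) ∂P := lintegral_mono fun ω => hq n hn _
      _ = q * ∫⁻ ω, ψ (Z n ω) ∂P := lintegral_const_mul _ hψm
      _ ≤ q * (q ^ n * ∫⁻ ω, ψ (Z 0 ω) ∂P) := by gcongr; exact ih (by omega)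
      _ = _ := by rw [pow_succ']; ring

end Recursion

/-! ### Lyapunov functions of the schemes -/

section Lyapunov

/-- Jensen's inequality for the fourth power and the weights `1 + κ` and `κ`. -/
theorem add_mul_pow_four_le {κ a b : ℝ} (hκ : 0 ≤ κ) :
    (a + κ * (a + b)) ^ 4 ≤ (1 + 2 * κ) ^ 3 * ((1 + κ) * a ^ 4 + κ * b ^ 4) := by
  have key : ∀ x y : ℝ, ((1 + κ) * x + κ * y) ^ 2
      ≤ (1 + 2 * κ) * ((1 + κ) * x ^ 2 + κ * y ^ 2) := by
    intro x y
    nlinarith [mul_nonneg (mul_nonneg hκ (by linarith : 0 ≤ 1 + κ)) (sq_nonneg (x - y))]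
  have h1 := key a b
  have h2 := key (a ^ 2) (b ^ 2)
  have h3 := pow_le_pow_left₀ (sq_nonneg _) h1 2
  calc (a + κ * (a + b)) ^ 4 = (((1 + κ) * a + κ * b) ^ 2) ^ 2 := by ring
    _ ≤ ((1 + 2 * κ) * ((1 + κ) * a ^ 2 + κ * b ^ 2)) ^ 2 := h3
    _ = (1 + 2 * κ) ^ 2 * ((1 + κ) * a ^ 2 + κ * b ^ 2) ^ 2 := by ring
    _ ≤ (1 + 2 * κ) ^ 2 * ((1 + 2 * κ) * ((1 + κ) * (a ^ 2) ^ 2 + κ * (b ^ 2) ^ 2)) := by gcongr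
    _ = _ := by ring

theorem one_add_sq_pow_four_le (s : ℝ) : (1 + s ^ 2) ^ 4 ≤ 8 * (1 + s ^ 8) := by
  have h := add_pow_le zero_le_one (sq_nonneg s) 4
  norm_num at h
  rw [← pow_mul] at h
  norm_num at h
  exact h

variable {U : Type*} [NormedAddCommGroup U] [InnerProductSpace ℝ U] [CompleteSpace U]
variable [MeasurableSpace U] [BorelSpace U] {c : CovOp U}
variable {H : Type*} [NormedAddCommGroup H] [InnerProductSpace ℝ H] [CompleteSpace H]
variable {VN : Submodule ℝ H} [FiniteDimensional ℝ VN] {F : H → H} {G : H → HS c H} {L : ℝ}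
variable {Ω : Type*} {mΩ : MeasurableSpace Ω} {P : Measure Ω} [IsProbabilityMeasure P]
variable {u : Ω → U} {h : ℝ≥0}

omit [IsProbabilityMeasure P] in
theorem lintegral_ofReal_le {g : Ω → ℝ} (hg : Integrable g P) (h0 : ∀ ω, 0 ≤ g ω) {a : ℝ}
    (ha : ∫ ω, g ω ∂P ≤ a) : ∫⁻ ω, ENNReal.ofReal (g ω) ∂P ≤ ENNReal.ofReal a := by
  rw [← ofReal_integral_eq_lintegral_ofReal hg (ae_of_all _ h0)]
  exact ENNReal.ofReal_le_ofReal ha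

/-- `ρ (1 + ‖·‖⁸)` is a Lyapunov function of the Milstein scheme. -/
theorem lintegral_milsteinStep_le (hFG : CoeffBound F G L) (K : ℕ)
    (hξ : IsNoise P (fun k ω => coord c k (u ω)) (fun k => coordVar c h k) gaussConst h)
    {T : ℝ} (hT : h ≤ T) {R : H → H} (hR : ∀ v, ‖R v‖ ≤ ‖v‖) (y : H) {ρ : ℝ} (hρ : 0 ≤ ρ) :
    ∫⁻ ω, ENNReal.ofReal (ρ * (1 + ‖R (milsteinStep VN F G h K y (u ω))‖ ^ 8)) ∂P ≤
      ENNReal.ofReal ((1 + 2 * (stepConst T L * h)) ^ 5) *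
        ENNReal.ofReal (ρ * (1 + ‖y‖ ^ 8)) := by
  have hb := momentBound_milsteinStep VN K hFG hξ hT y
  have hκ : 0 ≤ stepConst T L * h :=
    mul_nonneg (stepConst_nonneg (h.2.trans hT) hFG.nonneg) h.2
  rw [← ENNReal.ofReal_mul (by positivity)]
  refine (lintegral_mono fun ω => ENNReal.ofReal_le_ofReal (mul_le_mul_of_nonneg_left
    (add_le_add_right (pow_le_pow_left₀ (norm_nonneg _) (hR _) 8) 1) hρ)).trans ?_
  have hi : Integrable (fun ω => 1 + ‖milsteinStep VN F G h K y (u ω)‖ ^ 8) P :=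
    (integrable_const 1).add hb.int
  refine lintegral_ofReal_le (hi.const_mul ρ) (fun ω => by positivity) ?_
  rw [integral_const_mul, integral_add (integrable_const 1) hb.int, mul_left_comm]
  refine mul_le_mul_of_nonneg_left ?_ hρ
  have h1 := hb.le
  set κ := stepConst T L * h with hκ'
  rw [add_comm (1 : ℝ) (‖y‖ ^ 2)] at h1
  have h2 := h1.trans (add_mul_pow_four_le hκ)
  simp only [integral_const, probReal_univ, smul_eq_mul, mul_one]
  have e : (‖y‖ ^ 2) ^ 4 = ‖y‖ ^ 8 := by ring
  rw [e] at h2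
  have hy : 0 ≤ ‖y‖ ^ 8 := by positivity
  have hq : (1 : ℝ) ≤ (1 + 2 * κ) ^ 3 := one_le_pow₀ (by linarith)
  have h3 : (1 + 2 * κ) ^ 4 ≤ (1 + 2 * κ) ^ 5 :=
    pow_le_pow_right₀ (by linarith) (by norm_num)
  calc 1 + ∫ ω, ‖milsteinStep VN F G h K y (u ω)‖ ^ 8 ∂P
      ≤ 1 + (1 + 2 * κ) ^ 3 * ((1 + κ) * ‖y‖ ^ 8 + κ * 1 ^ 4) := by linarith
    _ ≤ (1 + 2 * κ) ^ 3 + (1 + 2 * κ) ^ 3 * ((1 + κ) * ‖y‖ ^ 8 + κ * 1 ^ 4) := by linarith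
    _ = (1 + 2 * κ) ^ 3 * (1 + κ) * (1 + ‖y‖ ^ 8) := by ring
    _ ≤ (1 + 2 * κ) ^ 3 * (1 + 2 * κ) * (1 + ‖y‖ ^ 8) := by gcongr; linarith
    _ = (1 + 2 * κ) ^ 4 * (1 + ‖y‖ ^ 8) := by ring
    _ ≤ _ := mul_le_mul_of_nonneg_right h3 (by positivity)

/-- The function `‖y - z‖⁸ + 8 h⁴ (1 + ‖y‖⁸)`, whose expectation at `y = Y_m`, `z = Ŷ_m` grows at
most exponentially in time. -/
noncomputable def errorFun (h : ℝ) (p : H × H) : ℝ :=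
  ‖p.1 - p.2‖ ^ 8 + 8 * h ^ 4 * (1 + ‖p.1‖ ^ 8)

omit [InnerProductSpace ℝ H] [CompleteSpace H] in
theorem continuous_errorFun (h : ℝ) : Continuous (errorFun (H := H) h) := by
  unfold errorFun
  fun_prop

theorem lintegral_errorFun_step_le (hFG : CoeffBound F G L) (K : ℕ)
    (hξ : IsNoise P (fun k ω => coord c k (u ω)) (fun k => coordVar c h k) gaussConst h)
    {T : ℝ} (hT : h ≤ T) {R : H → H} (hR : ∀ v, ‖R v‖ ≤ ‖v‖)
    (hR' : ∀ v w, R (v - w) = R v - R w) (p : H × H) :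
    ∫⁻ ω, ENNReal.ofReal (errorFun h (R (milsteinStep VN F G h K p.1 (u ω)),
        R (eulerStep F G h K p.2 (u ω)))) ∂P ≤
      ENNReal.ofReal ((1 + 2 * (stepConst T L * h)) ^ 5) * ENNReal.ofReal (errorFun h p) := by
  obtain ⟨y, z⟩ := p
  have hb := momentBound_milsteinStep VN K hFG hξ hT y
  have hd := momentBound_milsteinStep_sub_eulerStep VN K hFG hξ hT y z
  have hκ : 0 ≤ stepConst T L * h :=
    mul_nonneg (stepConst_nonneg (h.2.trans hT) hFG.nonneg) h.2
  have hi : Integrable (fun ω => 8 * (h : ℝ) ^ 4 * (1 + ‖milsteinStep VN F G h K y (u ω)‖ ^ 8)) P :=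
    ((integrable_const 1).add hb.int).const_mul _
  simp only
  have hmono : ∀ ω, errorFun h (R (milsteinStep VN F G h K y (u ω)),
      R (eulerStep F G h K z (u ω))) ≤
      ‖milsteinStep VN F G h K y (u ω) - eulerStep F G h K z (u ω)‖ ^ 8 +
        8 * (h : ℝ) ^ 4 * (1 + ‖milsteinStep VN F G h K y (u ω)‖ ^ 8) := by
    intro ω
    rw [errorFun]
    simp only
    rw [← hR']
    gcongr
    · exact hR _
    · exact hR _
  have h0 : 0 ≤ errorFun h (y, z) := by
    rw [errorFun]; positivity
  rw [← ENNReal.ofReal_mul (by positivity)]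
  refine (lintegral_mono fun ω => ENNReal.ofReal_le_ofReal (hmono ω)).trans ?_
  refine lintegral_ofReal_le (g := fun ω =>
    ‖milsteinStep VN F G h K y (u ω) - eulerStep F G h K z (u ω)‖ ^ 8 +
      8 * (h : ℝ) ^ 4 * (1 + ‖milsteinStep VN F G h K y (u ω)‖ ^ 8))
    (hd.int.add hi) (fun ω => by positivity) ?_
  rw [integral_add hd.int hi, integral_const_mul, integral_add (integrable_const 1) hb.int,
    errorFun]
  simp only [integral_const, probReal_univ, smul_eq_mul, mul_one]
  have h1 := hb.le
  have h1' := hd.le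
  set κ := stepConst T L * h with hκ'
  rw [add_comm (1 : ℝ) (‖y‖ ^ 2)] at h1
  have h2 := h1.trans (add_mul_pow_four_le hκ)
  have h2' := h1'.trans (add_mul_pow_four_le hκ)
  have e : (‖y‖ ^ 2) ^ 4 = ‖y‖ ^ 8 := by ring
  have e' : (‖y - z‖ ^ 2) ^ 4 = ‖y - z‖ ^ 8 := by ring
  rw [e] at h2
  rw [e', mul_pow] at h2'
  have hy : 0 ≤ ‖y‖ ^ 8 := by positivity
  have h5 := one_add_sq_pow_four_le ‖y‖
  set q := 1 + 2 * κ with hq'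
  have hq1 : 1 ≤ q := by linarith
  have hq : (1 : ℝ) ≤ q ^ 3 := one_le_pow₀ hq1
  set d := ‖y - z‖ ^ 8 with hd'
  have hd0 : 0 ≤ d := by positivity
  set Y := 8 * (h : ℝ) ^ 4 * (1 + ‖y‖ ^ 8) with hY
  have hY0 : 0 ≤ Y := by positivity
  have s1 : ∫ ω, ‖milsteinStep VN F G h K y (u ω) - eulerStep F G h K z (u ω)‖ ^ 8 ∂P
      ≤ q ^ 3 * ((1 + κ) * d + κ * Y) := by
    refine h2'.trans ?_
    have : (h : ℝ) ^ 4 * (1 + ‖y‖ ^ 2) ^ 4 ≤ Y := by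
      rw [hY]
      calc _ ≤ (h : ℝ) ^ 4 * (8 * (1 + ‖y‖ ^ 8)) := by gcongr
        _ = _ := by ring
    gcongr
  have s2 : 8 * (h : ℝ) ^ 4 * (1 + ∫ ω, ‖milsteinStep VN F G h K y (u ω)‖ ^ 8 ∂P)
      ≤ q ^ 3 * (1 + κ) * Y := by
    have : 1 + ∫ ω, ‖milsteinStep VN F G h K y (u ω)‖ ^ 8 ∂P
        ≤ q ^ 3 * (1 + κ) * (1 + ‖y‖ ^ 8) := by
      calc _ ≤ q ^ 3 + q ^ 3 * ((1 + κ) * ‖y‖ ^ 8 + κ * 1 ^ 4) := by linarith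
        _ = _ := by ring
    calc _ ≤ 8 * (h : ℝ) ^ 4 * (q ^ 3 * (1 + κ) * (1 + ‖y‖ ^ 8)) := by gcongr
      _ = _ := by rw [hY]; ring
  calc _ ≤ q ^ 3 * ((1 + κ) * d + κ * Y) + q ^ 3 * (1 + κ) * Y := add_le_add s1 s2
    _ = q ^ 3 * ((1 + κ) * d + q * Y) := by rw [hq']; ring
    _ ≤ q ^ 3 * (q * d + q * Y) := by gcongr; linarith
    _ = q ^ 4 * (d + Y) := by ring
    _ ≤ q ^ 5 * (d + Y) := mul_le_mul_of_nonneg_right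
        (pow_le_pow_right₀ hq1 (by norm_num)) (by positivity)

end Lyapunov

/-! ### The schemes as recursions driven by the increments of the Wiener process -/

section Schemes

theorem gridTime_mono (T : ℝ≥0) (M : ℕ) {m n : ℕ} (h : m ≤ n) : gridTime T M m ≤ gridTime T M n := by
  unfold gridTime
  gcongr

theorem gridTime_le (T : ℝ≥0) {M m : ℕ} (hM : 1 ≤ M) (h : m ≤ M) : gridTime T M m ≤ T := by
  have hM0 : (M : ℝ≥0) ≠ 0 := by positivity
  refine (gridTime_mono T M h).trans_eq ?_
  unfold gridTime
  field_simp

theorem gridTime_succ_sub (T : ℝ≥0) (M m : ℕ) :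
    gridTime T M (m + 1) - gridTime T M m = T / M := by
  unfold gridTime
  have : ((m + 1 : ℕ) : ℝ≥0) * T / M = m * T / M + T / M := by
    push_cast
    ring
  rw [this, add_tsub_cancel_left]

theorem step_le (T : ℝ≥0) {M : ℕ} (hM : 1 ≤ M) : ((T / M : ℝ≥0) : ℝ) ≤ T := by
  have : T / M ≤ T := div_le_self zero_le (by exact_mod_cast hM)
  exact_mod_cast this

/-- The increment of the path between two grid points. -/
noncomputable def gridIncr {U Ω : Type*} [NormedAddCommGroup U] (W : ℝ≥0 → Ω → U) (T : ℝ≥0)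
    (M m : ℕ) (ω : Ω) : U :=
  W (gridTime T M (m + 1)) ω - W (gridTime T M m) ω

variable {U : Type*} [NormedAddCommGroup U] [InnerProductSpace ℝ U] [CompleteSpace U]
variable {c : CovOp U}
variable {H : Type*} [NormedAddCommGroup H] [InnerProductSpace ℝ H] [CompleteSpace H]
variable {Ω : Type*} {mΩ : MeasurableSpace Ω}

section Recursion

variable (S : Generator H) (F : H → H) (G : H → HS c H) (r : RatFunc ℝ) (T : ℝ≥0)
variable (W : ℝ≥0 → Ω → U) (X₀ : Ω → H) (VN : Submodule ℝ H) [FiniteDimensional ℝ VN]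
variable (hVN : VN ≤ S.dotH 1) (M K : ℕ)

theorem op_noiseIncr (O : HS c H) (m : ℕ) (ω : Ω) :
    HS.op O (noiseIncr c W T M K m ω) =
      ∑ k ∈ Finset.range K, coord c k (gridIncr W T M m ω) • HS.op O (c.b k) := by
  rw [noiseIncr, map_sum]
  simp_rw [map_smul]
  rfl

theorem milstein_succ (m : ℕ) (ω : Ω) :
    milstein S c F G r T W X₀ VN hVN M K (m + 1) ω =
      S.ratApprox VN hVN r ((T / M : ℝ≥0) : ℝ) (milsteinStep VN F G ((T / M : ℝ≥0) : ℝ) K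
        (milstein S c F G r T W X₀ VN hVN M K m ω) (gridIncr W T M m ω)) := by
  rw [milstein]
  rw [ratApprox_starProjection, op_noiseIncr, NNReal.coe_div, NNReal.coe_natCast]
  rfl

theorem euler_succ (m : ℕ) (ω : Ω) :
    euler S c F G r T W X₀ VN hVN M K (m + 1) ω =
      S.ratApprox VN hVN r ((T / M : ℝ≥0) : ℝ) (eulerStep F G ((T / M : ℝ≥0) : ℝ) K
        (euler S c F G r T W X₀ VN hVN M K m ω) (gridIncr W T M m ω)) := by
  rw [euler]
  rw [ratApprox_starProjection, ratApprox_starProjection, ← ratApprox_add, ← ratApprox_add,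
    op_noiseIncr, NNReal.coe_div, NNReal.coe_natCast]
  rfl

end Recursion

variable [MeasurableSpace U] [BorelSpace U]
variable {P : Measure Ω} [IsProbabilityMeasure P] {𝓕 : Filtration ℝ≥0 mΩ} {T : ℝ≥0}
variable {W : ℝ≥0 → Ω → U}

omit [IsProbabilityMeasure P] [CompleteSpace U] in
theorem stronglyMeasurable_gridIncr (hW : IsQWiener c T 𝓕 P W) {M m : ℕ} (hM : 1 ≤ M)
    (hm : m < M) : StronglyMeasurable[𝓕 (gridTime T M (m + 1))] (gridIncr W T M m) := by
  have h1 := hW.adapted _ (gridTime_le T hM hm)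
  have h2 := (hW.adapted _ (gridTime_le T hM hm.le)).mono
    (𝓕.mono (gridTime_mono T M (Nat.le_succ m)))
  exact h1.sub h2

theorem isNoise_gridIncr (hW : IsQWiener c T 𝓕 P W) {M m : ℕ} (hM : 1 ≤ M) (hm : m < M) :
    IsNoise P (fun k ω => coord c k (gridIncr W T M m ω))
      (fun k => coordVar c (T / M) k) gaussConst (T / M : ℝ≥0) := by
  refine isNoise_coord c
    ((stronglyMeasurable_gridIncr hW hM hm).mono (𝓕.le _)).measurable fun φ => ?_
  rw [← gridTime_succ_sub T M m]
  exact hW.gaussian _ _ (gridTime_mono T M (Nat.le_succ m)) (gridTime_le T hM hm) φ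

variable {S : Generator H} {F : H → H} {G : H → HS c H} {L : ℝ} {r : RatFunc ℝ} {X₀ : Ω → H}
variable {VN : Submodule ℝ H} [FiniteDimensional ℝ VN]

theorem growth_pow_le {T : ℝ≥0} {M n : ℕ} (hM : 1 ≤ M) (hn : n ≤ M) {C : ℝ} (hC : 0 ≤ C) :
    ENNReal.ofReal ((1 + 2 * (C * (T / M : ℝ≥0))) ^ 5) ^ n ≤
      ENNReal.ofReal (Real.exp (10 * C * T)) := by
  have hM0 : (0 : ℝ) < M := by positivity
  rw [← ENNReal.ofReal_pow (by positivity)]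
  refine ENNReal.ofReal_le_ofReal ?_
  have h1 : 1 + 2 * (C * ((T / M : ℝ≥0) : ℝ)) ≤ Real.exp (2 * (C * (T / M : ℝ≥0))) := by
    rw [add_comm]; exact Real.add_one_le_exp _
  rw [← pow_mul]
  refine (pow_le_pow_left₀ (by positivity) h1 _).trans ?_
  rw [← Real.exp_nat_mul]
  refine Real.exp_le_exp.2 ?_
  have h2 : (n : ℝ) ≤ M := by exact_mod_cast hn
  push_cast
  calc (5 * n : ℝ) * (2 * (C * (T / M))) ≤ (5 * M : ℝ) * (2 * (C * (T / M))) := by gcongr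
    _ = _ := by field_simp; ring

/-- The weighted eighth moments of the Milstein scheme. The weight may be any function of the
initial value, so that the bound amounts to a bound for the moments conditionally on `X₀`. -/
theorem lintegral_milstein_le (hW : IsQWiener c T 𝓕 P W) (hT : 0 < T) (hFG : CoeffBound F G L)
    (hr : IsStableRational r) (hVN : VN ≤ S.dotH 1) (hX₀ : StronglyMeasurable[𝓕 0] X₀) {M : ℕ}
    (hM : 1 ≤ M) (K : ℕ) {ρ : H → ℝ} (hρ : Continuous ρ) (hρ0 : ∀ x, 0 ≤ ρ x) {m : ℕ}
    (hm : m ≤ M) :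
    ∫⁻ ω, ENNReal.ofReal (ρ (X₀ ω) *
        (1 + ‖milstein S c F G r T W X₀ VN hVN M K m ω‖ ^ 8)) ∂P ≤
      ENNReal.ofReal (Real.exp (10 * stepConst T L * T)) *
        ∫⁻ ω, ENNReal.ofReal (ρ (X₀ ω) * (1 + ‖X₀ ω‖ ^ 8)) ∂P := by
  borelize H
  have := secondCountable_of_hilbertBasis S.f
  have := secondCountable_of_hilbertBasis c.e
  have hh : (0 : ℝ) < (T / M : ℝ≥0) := by
    have : (0 : ℝ≥0) < T / M := by positivity
    exact_mod_cast this
  have h1 := lintegral_recursion_le (P := P) (M := M) (m := fun n => 𝓕 (gridTime T M n))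
    (Z := fun n ω => (X₀ ω, milstein S c F G r T W X₀ VN hVN M K n ω)) (u := gridIncr W T M)
    (Φ := fun p => (p.1.1, S.ratApprox VN hVN r ((T / M : ℝ≥0) : ℝ)
      (milsteinStep VN F G ((T / M : ℝ≥0) : ℝ) K p.1.2 p.2)))
    (ψ := fun p => ENNReal.ofReal (ρ p.1 * (1 + ‖p.2‖ ^ 8)))
    (q := ENNReal.ofReal ((1 + 2 * (stepConst T L * (T / M : ℝ≥0))) ^ 5))
    (fun n => 𝓕.le _) (fun n _ => 𝓕.mono (gridTime_mono T M (Nat.le_succ n)))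
    (by
      have h0 := hX₀.mono (𝓕.mono (zero_le (a := gridTime T M 0)))
      exact h0.measurable.prodMk (VN.starProjection.continuous.comp_stronglyMeasurable h0).measurable)
    (fun n hn => (stronglyMeasurable_gridIncr hW hM hn).measurable)
    (fun n hn => hW.indep _ _ (gridTime_mono T M (Nat.le_succ n)) (gridTime_le T hM hn))
    (by
      have hc : Continuous fun p : (H × H) × U => (p.1.1, S.ratApprox VN hVN r ((T / M : ℝ≥0) : ℝ)
          (milsteinStep VN F G ((T / M : ℝ≥0) : ℝ) K p.1.2 p.2)) :=
        (continuous_fst.comp continuous_fst).prodMk ((continuous_ratApprox S VN hVN r _).comp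
          ((continuous_milsteinStep VN _ K hFG).comp
            ((continuous_snd.comp continuous_fst).prodMk continuous_snd)))
      exact hc.measurable)
    (fun n _ ω => by rw [milstein_succ])
    (by
      have hc : Continuous fun p : H × H => ENNReal.ofReal (ρ p.1 * (1 + ‖p.2‖ ^ 8)) :=
        ENNReal.continuous_ofReal.comp (by fun_prop)
      exact hc.measurable)
    (fun n hn x => lintegral_milsteinStep_le hFG K (isNoise_gridIncr hW hM hn) (step_le T hM)
      (norm_ratApprox_le S VN hVN hr hh) x.2 (hρ0 x.1)) m hm
  refine h1.trans (mul_le_mul' (growth_pow_le hM hm (stepConst_nonneg T.2 hFG.nonneg))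
    (lintegral_mono fun ω => ENNReal.ofReal_le_ofReal ?_))
  refine mul_le_mul_of_nonneg_left ?_ (hρ0 _)
  have h2 : ‖VN.starProjection (X₀ ω)‖ ≤ ‖X₀ ω‖ :=
    (ContinuousLinearMap.le_of_opNorm_le _ (Submodule.starProjection_norm_le _) _).trans_eq
      (one_mul _)
  simp only [milstein]
  gcongr

/-- The eighth moments of the difference of the schemes are of order `h⁴`. -/
theorem lintegral_milstein_sub_euler_le (hW : IsQWiener c T 𝓕 P W) (hT : 0 < T)
    (hFG : CoeffBound F G L) (hr : IsStableRational r) (hVN : VN ≤ S.dotH 1)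
    (hX₀ : StronglyMeasurable[𝓕 0] X₀) {M : ℕ} (hM : 1 ≤ M) (K : ℕ) {m : ℕ} (hm : m ≤ M) :
    AEStronglyMeasurable (fun ω => milstein S c F G r T W X₀ VN hVN M K m ω
      - euler S c F G r T W X₀ VN hVN M K m ω) P ∧
    ∫⁻ ω, ENNReal.ofReal (‖milstein S c F G r T W X₀ VN hVN M K m ω
      - euler S c F G r T W X₀ VN hVN M K m ω‖ ^ 8) ∂P ≤
      ENNReal.ofReal (Real.exp (10 * stepConst T L * T)) *
        (ENNReal.ofReal (8 * (T / M : ℝ≥0) ^ 4) * ∫⁻ ω, ENNReal.ofReal (1 + ‖X₀ ω‖ ^ 8) ∂P) := by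
  borelize H
  have := secondCountable_of_hilbertBasis S.f
  have := secondCountable_of_hilbertBasis c.e
  have hh : (0 : ℝ) < (T / M : ℝ≥0) := by
    have : (0 : ℝ≥0) < T / M := by positivity
    exact_mod_cast this
  set Z : ℕ → Ω → H × H := fun n ω => (milstein S c F G r T W X₀ VN hVN M K n ω,
    euler S c F G r T W X₀ VN hVN M K n ω) with hZ
  set Φ : (H × H) × U → H × H := fun p => (S.ratApprox VN hVN r ((T / M : ℝ≥0) : ℝ)
      (milsteinStep VN F G ((T / M : ℝ≥0) : ℝ) K p.1.1 p.2),
    S.ratApprox VN hVN r ((T / M : ℝ≥0) : ℝ)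
      (eulerStep F G ((T / M : ℝ≥0) : ℝ) K p.1.2 p.2)) with hΦ
  have hmono : ∀ n < M, 𝓕 (gridTime T M n) ≤ 𝓕 (gridTime T M (n + 1)) := fun n _ =>
    𝓕.mono (gridTime_mono T M (Nat.le_succ n))
  have hZ0 : Measurable[𝓕 (gridTime T M 0)] (Z 0) := by
    have h0 := hX₀.mono (𝓕.mono (zero_le (a := gridTime T M 0)))
    have h1 := (VN.starProjection.continuous.comp_stronglyMeasurable h0).measurable
    exact h1.prodMk h1
  have hu : ∀ n < M, Measurable[𝓕 (gridTime T M (n + 1))] (gridIncr W T M n) := fun n hn =>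
    (stronglyMeasurable_gridIncr hW hM hn).measurable
  have hΦm : Measurable Φ := by
    have hR := continuous_ratApprox S VN hVN r ((T / M : ℝ≥0) : ℝ)
    have hc : Continuous Φ :=
      (hR.comp ((continuous_milsteinStep VN _ K hFG).comp
        ((continuous_fst.comp continuous_fst).prodMk continuous_snd))).prodMk
      (hR.comp ((continuous_eulerStep _ K hFG).comp
        ((continuous_snd.comp continuous_fst).prodMk continuous_snd)))
    exact hc.measurable
  have hstep : ∀ n < M, ∀ ω, Z (n + 1) ω = Φ (Z n ω, gridIncr W T M n ω) := fun n _ ω => by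
    simp only [hZ, hΦ]
    rw [milstein_succ, euler_succ]
  have hψ : Measurable fun p : H × H => ENNReal.ofReal (errorFun ((T / M : ℝ≥0) : ℝ) p) :=
    (ENNReal.continuous_ofReal.comp (continuous_errorFun _)).measurable
  constructor
  · have h1 := (measurable_recursion (m := fun n => 𝓕 (gridTime T M n)) hmono hZ0 hu hΦm hstep
      m hm).mono (𝓕.le _) le_rfl
    exact (h1.fst.sub h1.snd).aestronglyMeasurable
  · have h1 := lintegral_recursion_le (P := P) (m := fun n => 𝓕 (gridTime T M n))
      (q := ENNReal.ofReal ((1 + 2 * (stepConst T L * (T / M : ℝ≥0))) ^ 5))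
      (fun n => 𝓕.le _) hmono hZ0 hu
      (fun n hn => hW.indep _ _ (gridTime_mono T M (Nat.le_succ n)) (gridTime_le T hM hn))
      hΦm hstep hψ
      (fun n hn x => lintegral_errorFun_step_le hFG K (isNoise_gridIncr hW hM hn) (step_le T hM)
        (norm_ratApprox_le S VN hVN hr hh) (ratApprox_sub S VN hVN r _) x) m hm
    refine le_trans (lintegral_mono fun ω => ENNReal.ofReal_le_ofReal ?_) (h1.trans
      (mul_le_mul' (growth_pow_le hM hm (stepConst_nonneg T.2 hFG.nonneg)) ?_))
    · simp only [errorFun, hZ]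
      exact le_add_of_nonneg_right (by positivity)
    · rw [← lintegral_const_mul' _ _ ENNReal.ofReal_ne_top]
      refine lintegral_mono fun ω => ?_
      rw [← ENNReal.ofReal_mul (by positivity)]
      refine ENNReal.ofReal_le_ofReal ?_
      have h2 : ‖VN.starProjection (X₀ ω)‖ ≤ ‖X₀ ω‖ :=
        (ContinuousLinearMap.le_of_opNorm_le _ (Submodule.starProjection_norm_le _) _).trans_eq
          (one_mul _)
      simp only [errorFun, hZ, milstein, euler, sub_self, norm_zero]
      rw [zero_pow (by norm_num), zero_add]
      gcongr

end Schemes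

/-! ### Moments of the initial value -/

section Initial

variable {H : Type*} [NormedAddCommGroup H] [InnerProductSpace ℝ H] [CompleteSpace H]
variable {Ω : Type*} {mΩ : MeasurableSpace Ω} {P : Measure Ω}

theorem enorm_sq_le_dotNorm_sq (S : Generator H) {α : ℝ} (hα : 0 ≤ α) (v : H) :
    ‖v‖ₑ ^ 2 ≤ ENNReal.ofReal ((S.lam 0 ^ α)⁻¹) * S.dotNorm α v ^ 2 := by
  have h1 : HasSum (fun n => ⟪S.f n, v⟫ ^ 2) (‖v‖ ^ 2) := by
    have h := S.f.hasSum_inner_mul_inner v v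
    rw [real_inner_self_eq_norm_sq] at h
    exact h.congr_fun fun n => by rw [real_inner_comm, sq]
  have h2 : S.dotNorm α v ^ 2 = ∑' n, ENNReal.ofReal (S.lam n ^ α * ⟪S.f n, v⟫ ^ 2) := by
    rw [Generator.dotNorm, ← ENNReal.rpow_natCast, ← ENNReal.rpow_mul]
    norm_num
  have h3 : ‖v‖ₑ ^ 2 = ∑' n, ENNReal.ofReal (⟪S.f n, v⟫ ^ 2) := by
    rw [← ofReal_norm, ← ENNReal.ofReal_pow (norm_nonneg _), ← h1.tsum_eq,
      ENNReal.ofReal_tsum_of_nonneg (fun n => sq_nonneg _) h1.summable]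
  rw [h2, h3, ← ENNReal.tsum_mul_left]
  refine ENNReal.tsum_le_tsum fun n => ?_
  have h0 : 0 < S.lam 0 ^ α := Real.rpow_pos_of_pos (S.lam_pos 0) α
  have hn : S.lam 0 ^ α ≤ S.lam n ^ α :=
    Real.rpow_le_rpow (S.lam_pos 0).le (S.lam_mono (Nat.zero_le n)) hα
  rw [← ENNReal.ofReal_mul (by positivity), ← mul_assoc]
  refine ENNReal.ofReal_le_ofReal (le_mul_of_one_le_left (sq_nonneg _) ?_)
  rw [inv_mul_eq_div, one_le_div h0]
  exact hn

theorem lintegral_enorm_pow_eight_lt_top {S : Generator H} {α : ℝ} (hα : 0 ≤ α)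
    {𝓕 : Filtration ℝ≥0 mΩ} {X₀ : Ω → H} (hX₀ : InitialAssumption S α 𝓕 P X₀) :
    ∫⁻ ω, ‖X₀ ω‖ₑ ^ 8 ∂P < ∞ := by
  have h1 : ∀ ω, ‖X₀ ω‖ₑ ^ 8 ≤
      ENNReal.ofReal ((S.lam 0 ^ α)⁻¹) ^ 4 * S.dotNorm α (X₀ ω) ^ 8 := by
    intro ω
    calc ‖X₀ ω‖ₑ ^ 8 = (‖X₀ ω‖ₑ ^ 2) ^ 4 := by rw [← pow_mul]
      _ ≤ (ENNReal.ofReal ((S.lam 0 ^ α)⁻¹) * S.dotNorm α (X₀ ω) ^ 2) ^ 4 :=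
          pow_le_pow_left' (enorm_sq_le_dotNorm_sq S hα _) 4
      _ = _ := by rw [mul_pow, ← pow_mul]
  refine (lintegral_mono h1).trans_lt ?_
  rw [lintegral_const_mul' _ _ (ENNReal.pow_ne_top ENNReal.ofReal_ne_top)]
  exact ENNReal.mul_lt_top (ENNReal.pow_lt_top ENNReal.ofReal_lt_top) hX₀.moment

variable [IsProbabilityMeasure P]

theorem lintegral_enorm_rpow_lt_top {S : Generator H} {α : ℝ} (hα : 0 ≤ α)
    {𝓕 : Filtration ℝ≥0 mΩ} {X₀ : Ω → H} (hX₀ : InitialAssumption S α 𝓕 P X₀) {p : ℝ} (hp0 : 0 ≤ p)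
    (hp : p ≤ 8) : ∫⁻ ω, ‖X₀ ω‖ₑ ^ p ∂P < ∞ := by
  have h1 : ∀ ω, ‖X₀ ω‖ₑ ^ p ≤ 1 + ‖X₀ ω‖ₑ ^ 8 := by
    intro ω
    rcases le_total ‖X₀ ω‖ₑ 1 with h | h
    · exact (ENNReal.rpow_le_one h hp0).trans le_self_add
    · refine le_trans ?_ le_add_self
      rw [← ENNReal.rpow_ofNat]
      exact ENNReal.rpow_le_rpow_of_exponent_le h hp
  refine (lintegral_mono h1).trans_lt ?_
  rw [lintegral_add_left measurable_const, lintegral_const, measure_univ, mul_one]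
  exact ENNReal.add_lt_top.2 ⟨ENNReal.one_lt_top, lintegral_enorm_pow_eight_lt_top hα hX₀⟩

theorem lintegral_one_add_pow_eight_lt_top {S : Generator H} {α : ℝ} (hα : 0 ≤ α)
    {𝓕 : Filtration ℝ≥0 mΩ} {X₀ : Ω → H} (hX₀ : InitialAssumption S α 𝓕 P X₀) :
    ∫⁻ ω, ENNReal.ofReal (1 + ‖X₀ ω‖ ^ 8) ∂P < ∞ := by
  have h1 : ∀ ω, ENNReal.ofReal (1 + ‖X₀ ω‖ ^ 8) = 1 + ‖X₀ ω‖ₑ ^ 8 := fun ω => by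
    rw [ENNReal.ofReal_add zero_le_one (by positivity), ENNReal.ofReal_one,
      ENNReal.ofReal_pow (norm_nonneg _), ofReal_norm]
  simp_rw [h1]
  rw [lintegral_add_left measurable_const, lintegral_const, measure_univ, mul_one]
  exact ENNReal.add_lt_top.2 ⟨ENNReal.one_lt_top, lintegral_enorm_pow_eight_lt_top hα hX₀⟩

end Initial

/-! ### From weighted eighth moments to moments of order `p` -/

section Powers

/-- If `y ≤ 1 + x`, the last summand dominates; otherwise the first one does, as `p - 8 ≤ 0`. -/
theorem rpow_le_weighted {p x y : ℝ} (hp0 : 0 ≤ p) (hp : p ≤ 8) (hx : 0 ≤ x) (hy : 0 ≤ y) :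
    y ^ p ≤ (1 + x) ^ (p - 8) * (1 + y ^ 8) + (1 + x) ^ p := by
  have hx1 : 0 < 1 + x := by linarith
  have hw : 0 < (1 + x) ^ (p - 8) := Real.rpow_pos_of_pos hx1 _
  rcases le_total y (1 + x) with h | h
  · have := Real.rpow_le_rpow hy h hp0
    have : 0 ≤ (1 + x) ^ (p - 8) * (1 + y ^ 8) := by positivity
    linarith
  · have hy0 : 0 < y := hx1.trans_le h
    have h1 : y ^ p = y ^ (p - 8) * y ^ 8 := by
      rw [← Real.rpow_natCast y 8, ← Real.rpow_add hy0]
      norm_num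
    have h2 : y ^ (p - 8) ≤ (1 + x) ^ (p - 8) :=
      Real.rpow_le_rpow_of_nonpos hx1 h (by linarith)
    have h3 := mul_le_mul_of_nonneg_right h2 (by positivity : 0 ≤ y ^ 8)
    have h4 : 0 ≤ (1 + x) ^ p := Real.rpow_nonneg hx1.le _
    rw [h1]
    nlinarith

theorem weighted_le_rpow {p x : ℝ} (hx : 0 ≤ x) :
    (1 + x) ^ (p - 8) * (1 + x ^ 8) ≤ (1 + x) ^ p := by
  have hx1 : 0 < 1 + x := by linarith
  have h1 : (1 + x) ^ p = (1 + x) ^ (p - 8) * (1 + x) ^ 8 := by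
    rw [← Real.rpow_natCast (1 + x) 8, ← Real.rpow_add hx1]
    norm_num
  rw [h1]
  refine mul_le_mul_of_nonneg_left ?_ (Real.rpow_nonneg hx1.le _)
  have := pow_add_pow_le zero_le_one hx (n := 8) (by norm_num)
  rwa [one_pow] at this

theorem one_add_rpow_le {p x : ℝ} (hp0 : 0 ≤ p) (hp : p ≤ 8) (hx : 0 ≤ x) :
    (1 + x) ^ p ≤ 256 * (1 + x ^ p) := by
  have h2 : (2 : ℝ) ^ p ≤ 256 := by
    calc (2 : ℝ) ^ p ≤ 2 ^ (8 : ℝ) := Real.rpow_le_rpow_of_exponent_le (by norm_num) hp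
      _ = 256 := by norm_num
  have hm : (max 1 x) ^ p ≤ 1 + x ^ p := by
    have := Real.rpow_nonneg hx p
    rcases le_total 1 x with h | h
    · rw [max_eq_right h]; linarith
    · rw [max_eq_left h, Real.one_rpow]; linarith
  calc (1 + x) ^ p ≤ (2 * max 1 x) ^ p := by
        refine Real.rpow_le_rpow (by positivity) ?_ hp0
        linarith [le_max_left 1 x, le_max_right 1 x]
    _ = 2 ^ p * (max 1 x) ^ p := Real.mul_rpow (by norm_num) (by positivity)
    _ ≤ 256 * (1 + x ^ p) := mul_le_mul h2 hm (by positivity) (by norm_num)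

variable {H : Type*} [NormedAddCommGroup H]
variable {Ω : Type*} {mΩ : MeasurableSpace Ω} {P : Measure Ω}

/-- A bound for the eighth moment of `Y` with the weight `(1 + ‖X‖)^{p - 8}` is a bound for the
moment of order `p`. -/
theorem lintegral_rpow_le_of_weighted [IsProbabilityMeasure P] {X Y : Ω → H}
    (hX : AEStronglyMeasurable X P) {p : ℝ} (hp0 : 0 ≤ p) (hp : p ≤ 8) {q : ℝ≥0}
    (h : ∫⁻ ω, ENNReal.ofReal ((1 + ‖X ω‖) ^ (p - 8) * (1 + ‖Y ω‖ ^ 8)) ∂P ≤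
      q * ∫⁻ ω, ENNReal.ofReal ((1 + ‖X ω‖) ^ (p - 8) * (1 + ‖X ω‖ ^ 8)) ∂P) :
    ∫⁻ ω, ‖Y ω‖ₑ ^ p ∂P ≤ ((q + 1) * 256 : ℝ≥0) * (1 + ∫⁻ ω, ‖X ω‖ₑ ^ p ∂P) := by
  have hrp : ∀ v : H, ‖v‖ₑ ^ p = ENNReal.ofReal (‖v‖ ^ p) := fun v => by
    rw [← ofReal_norm, ENNReal.ofReal_rpow_of_nonneg (norm_nonneg _) hp0]
  have h1 : ∫⁻ ω, ‖Y ω‖ₑ ^ p ∂P ≤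
      ∫⁻ ω, (ENNReal.ofReal ((1 + ‖X ω‖) ^ (p - 8) * (1 + ‖Y ω‖ ^ 8)) +
        ENNReal.ofReal ((1 + ‖X ω‖) ^ p)) ∂P := by
    refine lintegral_mono fun ω => ?_
    rw [hrp, ← ENNReal.ofReal_add (by positivity) (by positivity)]
    exact ENNReal.ofReal_le_ofReal (rpow_le_weighted hp0 hp (norm_nonneg _) (norm_nonneg _))
  have h2 : ∫⁻ ω, ENNReal.ofReal ((1 + ‖X ω‖) ^ (p - 8) * (1 + ‖X ω‖ ^ 8)) ∂P ≤
      ∫⁻ ω, ENNReal.ofReal ((1 + ‖X ω‖) ^ p) ∂P :=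
    lintegral_mono fun ω => ENNReal.ofReal_le_ofReal (weighted_le_rpow (norm_nonneg _))
  have h3 : ∫⁻ ω, ENNReal.ofReal ((1 + ‖X ω‖) ^ p) ∂P ≤ 256 * (1 + ∫⁻ ω, ‖X ω‖ₑ ^ p ∂P) := by
    have e : (1 : ℝ≥0∞) + ∫⁻ ω, ‖X ω‖ₑ ^ p ∂P = ∫⁻ ω, (1 + ‖X ω‖ₑ ^ p) ∂P := by
      rw [lintegral_add_left measurable_const, lintegral_const, measure_univ, mul_one]
    rw [e, ← lintegral_const_mul' _ _ (by norm_num)]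
    refine lintegral_mono fun ω => ?_
    refine (ENNReal.ofReal_le_ofReal (one_add_rpow_le hp0 hp (norm_nonneg _))).trans_eq ?_
    rw [ENNReal.ofReal_mul (by norm_num), ENNReal.ofReal_add zero_le_one (by positivity), hrp]
    simp
  have hXm : AEMeasurable (fun ω => ENNReal.ofReal ((1 + ‖X ω‖) ^ p)) P :=
    ((hX.norm.aemeasurable.const_add 1).pow_const p).ennreal_ofReal
  rw [lintegral_add_right' _ hXm] at h1
  calc _ ≤ q * ∫⁻ ω, ENNReal.ofReal ((1 + ‖X ω‖) ^ p) ∂P +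
        ∫⁻ ω, ENNReal.ofReal ((1 + ‖X ω‖) ^ p) ∂P :=
        h1.trans (add_le_add_left (h.trans (mul_le_mul_right h2 _)) _)
    _ = (q + 1) * ∫⁻ ω, ENNReal.ofReal ((1 + ‖X ω‖) ^ p) ∂P := by rw [add_mul, one_mul]
    _ ≤ (q + 1) * (256 * (1 + ∫⁻ ω, ‖X ω‖ₑ ^ p ∂P)) := by gcongr
    _ = _ := by push_cast; ring

/-- Jensen's inequality: a bound for the eighth moment is a bound for the moments of lower order. -/
theorem lintegral_rpow_rpow_le [IsProbabilityMeasure P] {D : Ω → H} (hD : AEStronglyMeasurable D P)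
    {p : ℝ} (hp0 : 0 < p) (hp : p ≤ 8) {B : ℝ≥0∞}
    (h : ∫⁻ ω, ENNReal.ofReal (‖D ω‖ ^ 8) ∂P ≤ B) :
    (∫⁻ ω, ‖D ω‖ₑ ^ p ∂P) ^ (1 / p) ≤ B ^ (1 / 8 : ℝ) := by
  have h1 := eLpNorm'_le_eLpNorm'_of_exponent_le hp0 hp P hD
  refine h1.trans ?_
  rw [eLpNorm'_eq_lintegral_enorm]
  refine ENNReal.rpow_le_rpow (le_trans (lintegral_mono fun ω => ?_) h) (by norm_num)
  rw [ENNReal.ofReal_pow (norm_nonneg _), ofReal_norm, ← ENNReal.rpow_ofNat]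

end Powers

end MilsteinSPDE

theorem theorem3p2
    {U : Type*} [NormedAddCommGroup U] [InnerProductSpace ℝ U] [CompleteSpace U]
    [MeasurableSpace U] [BorelSpace U]
    {H : Type*} [NormedAddCommGroup H] [InnerProductSpace ℝ H] [CompleteSpace H]
    {Ω : Type*} {mΩ : MeasurableSpace Ω} (P : Measure Ω) [IsProbabilityMeasure P]
    (𝓕 : Filtration ℝ≥0 mΩ) (h𝓕 : IsNormalFiltration 𝓕 P)
    (T : ℝ≥0) (hT : 0 < T)
    (c : CovOp U) (W : ℝ≥0 → Ω → U) (hW : IsQWiener c T 𝓕 P W)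
    (S : Generator H) (α : ℝ) (hα : 1 ≤ α)
    (F : H → H) (G : H → HS c H) (hFG : CoeffAssumption S c α F G)
    (r : RatFunc ℝ) (hr : IsStableRational r) :
    (∀ p : ℝ, 2 ≤ p → p ≤ 8 → ∃ C : ℝ≥0, 0 < C ∧
      ∀ X₀ : Ω → H, InitialAssumption S α 𝓕 P X₀ →
      (∀ M K : ℕ, 1 ≤ M → 1 ≤ K →
        ∀ (VN : Submodule ℝ H) [FiniteDimensional ℝ VN] (hVN : VN ≤ S.dotH 1),
        ∀ m ≤ M, ∫⁻ ω, ‖milstein S c F G r T W X₀ VN hVN M K m ω‖ₑ ^ p ∂P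
          ≤ C * (1 + ∫⁻ ω, ‖X₀ ω‖ₑ ^ p ∂P)) ∧
      C * (1 + ∫⁻ ω, ‖X₀ ω‖ₑ ^ p ∂P) < ∞) ∧
    (∀ X₀ : Ω → H, InitialAssumption S α 𝓕 P X₀ →
      ∀ p : ℝ, 0 < p → p ≤ 4 → ∃ C : ℝ≥0, 0 < C ∧
      ∀ M K : ℕ, 1 ≤ M → 1 ≤ K →
        ∀ (VN : Submodule ℝ H) [FiniteDimensional ℝ VN] (hVN : VN ≤ S.dotH 1),
        ∀ m ≤ M, (∫⁻ ω, ‖milstein S c F G r T W X₀ VN hVN M K m ω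
            - euler S c F G r T W X₀ VN hVN M K m ω‖ₑ ^ p ∂P) ^ (1 / p)
          ≤ C * ENNReal.ofReal ((M : ℝ) ^ (-(1 / 2) : ℝ))) := by
  obtain ⟨L, hL⟩ := exists_coeffBound hFG
  have hα0 : 0 ≤ α := zero_le_one.trans hα
  set Q : ℝ≥0 := Real.toNNReal (Real.exp (10 * stepConst T L * T)) with hQ
  refine ⟨fun p hp2 hp8 => ?_, fun X₀ hX₀ p hp0 hp4 => ?_⟩
  · have hp0 : 0 ≤ p := zero_le_two.trans hp2
    refine ⟨(Q + 1) * 256, by positivity, fun X₀ hX₀ => ⟨?_, ?_⟩⟩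
    · intro M K hM _ VN _ hVN m hm
      have hρ : Continuous fun x : H => (1 + ‖x‖) ^ (p - 8) :=
        Continuous.rpow_const (by fun_prop) fun x => Or.inl (by positivity)
      exact lintegral_rpow_le_of_weighted (hX₀.meas.mono (𝓕.le 0)).aestronglyMeasurable hp0 hp8
        (lintegral_milstein_le hW hT hL hr hVN hX₀.meas hM K hρ (fun x => by positivity) hm)
    · exact ENNReal.mul_lt_top ENNReal.coe_lt_top
        (ENNReal.add_lt_top.2 ⟨ENNReal.one_lt_top, lintegral_enorm_rpow_lt_top hα0 hX₀ hp0 hp8⟩)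
  · set I : ℝ≥0∞ := ∫⁻ ω, ENNReal.ofReal (1 + ‖X₀ ω‖ ^ 8) ∂P with hI
    have hIfin : I ≠ ∞ := (lintegral_one_add_pow_eight_lt_top hα0 hX₀).ne
    set B : ℝ≥0∞ := (Q * (8 * I)) ^ (1 / 8 : ℝ) * (T : ℝ≥0∞) ^ (1 / 2 : ℝ) with hB
    have hBfin : B ≠ ∞ := by
      refine ENNReal.mul_ne_top (ENNReal.rpow_ne_top_of_nonneg (by norm_num) ?_)
        (ENNReal.rpow_ne_top_of_nonneg (by norm_num) ENNReal.coe_ne_top)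
      exact ENNReal.mul_ne_top ENNReal.coe_ne_top (ENNReal.mul_ne_top (by norm_num) hIfin)
    refine ⟨B.toNNReal + 1, by positivity, fun M K hM _ VN _ hVN m hm => ?_⟩
    obtain ⟨h1, h2⟩ := lintegral_milstein_sub_euler_le hW hT hL hr hVN hX₀.meas hM K hm
    refine (lintegral_rpow_rpow_le h1 hp0 (hp4.trans (by norm_num)) h2).trans ?_
    have hM0 : (0 : ℝ) < M := by positivity
    have e1 : ENNReal.ofReal (8 * ((T / M : ℝ≥0) : ℝ) ^ 4) =
        8 * ((T : ℝ≥0∞) * ENNReal.ofReal ((M : ℝ)⁻¹)) ^ (4 : ℝ) := by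
      rw [ENNReal.ofReal_mul (by norm_num), ENNReal.ofReal_pow (NNReal.coe_nonneg _),
        NNReal.coe_div, div_eq_mul_inv, ENNReal.ofReal_mul (NNReal.coe_nonneg _),
        ENNReal.ofReal_coe_nnreal, NNReal.coe_natCast, ENNReal.rpow_ofNat]
      norm_num
    have e2 : ENNReal.ofReal ((M : ℝ)⁻¹) ^ (1 / 2 : ℝ) =
        ENNReal.ofReal ((M : ℝ) ^ (-(1 / 2) : ℝ)) := by
      rw [ENNReal.ofReal_rpow_of_nonneg (by positivity) (by norm_num), Real.rpow_neg hM0.le,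
        Real.inv_rpow hM0.le]
    have e3 : (ENNReal.ofReal (Real.exp (10 * stepConst T L * T)) *
        (ENNReal.ofReal (8 * ((T / M : ℝ≥0) : ℝ) ^ 4) * I)) ^ (1 / 8 : ℝ) =
        B * ENNReal.ofReal ((M : ℝ) ^ (-(1 / 2) : ℝ)) := by
      have e4 : (ENNReal.ofReal (Real.exp (10 * stepConst T L * T)) : ℝ≥0∞) = Q := rfl
      rw [e1, e4, ← e2, hB, mul_assoc _ ((T : ℝ≥0∞) ^ (1 / 2 : ℝ)),
        ← ENNReal.mul_rpow_of_nonneg _ _ (by norm_num : (0 : ℝ) ≤ 1 / 2)]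
      have e5 : (Q : ℝ≥0∞) * (8 * ((T : ℝ≥0∞) * ENNReal.ofReal ((M : ℝ)⁻¹)) ^ (4 : ℝ) * I) =
          Q * (8 * I) * ((T : ℝ≥0∞) * ENNReal.ofReal ((M : ℝ)⁻¹)) ^ (4 : ℝ) := by ring
      rw [e5, ENNReal.mul_rpow_of_nonneg _ _ (by norm_num), ← ENNReal.rpow_mul]
      norm_num
    rw [e3]
    gcongr
    push_cast
    rw [ENNReal.coe_toNNReal hBfin]
    exact le_self_add
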